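/- Let $d\ge 1$ be an integer. For $\mu\in\mathbb{R}$ set $\nu=\nu(\mu):=\tfrac12\sqrt{1-4\mu}$ if $\mu\le\tfrac14$ and $\nu:=\tfrac{i}{2}\sqrt{4\mu-1}$ if $\mu>\tfrac14$. Solutions are understood in the class $C([0,\infty);H^1(\mathbb{R}^d))\cap C^1([0,\infty);L^2(\mathbb{R}^d))$, with the equation holding in the sense of distributions, and $\|(f,g)\|_{\dot H^1\times L^2}:=(\|\nabla f\|_{L^2}^2+\|g\|_{L^2}^2)^{1/2}$. (i) Let $\mu\in\mathbb{R}$, $(v_0,v_1)\in H^1(\mathbb{R}^d)\times L^2(\mathbb{R}^d)$, and let $v$ be the solution of $$\partial_t^2 v-\Delta v+\frac{\mu}{(1+t)^2}v=0\ \text{ on }(0,\infty)\times\mathbb{R}^d,\qquad (v(0),\partial_t v(0))=(v_0,v_1).$$ If $\mu<0$, then $$\lim_{t\to\infty}(1+t)^{\frac12-\operatorname{Re}\nu}\,\|(v(t),\partial_t v(t))\|_{\dot H^1\times L^2}=0.$$ Moreover, for every $\mu\in\mathbb{R}$, $$\lim_{t\to\infty}(1+t)^{-\frac12-\operatorname{Re}\nu}\|v(t)\|_{L^2}=0\quad\text{if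 }\mu\ne\tfrac14,$$ $$\lim_{t\to\infty}(1+t)^{-\frac12}\{1+\log(1+t)\}^{-1}\|v(t)\|_{L^2}=0\quad\text{if }\mu=\tfrac14.$$ (ii) Let $\mu_1,\mu_2\in\mathbb{R}$, put $\mu:=\frac{\mu_1(2-\mu_1)}{4}+\mu_2$ and $\nu:=\nu(\mu)$, let $(u_0,u_1)\in H^1(\mathbb{R}^d)\times L^2(\mathbb{R}^d)$, and let $u$ be the solution of $$\partial_t^2 u-\Delta u+\frac{\mu_1}{1+t}\partial_t u+\frac{\mu_2}{(1+t)^2}u=0\ \text{ on }(0,\infty)\times\mathbb{R}^d,\qquad (u(0),\partial_t u(0))=(u_0,u_1).$$ Then $$\lim_{t\to\infty}(1+t)^{\frac12-\operatorname{Re}\nu+\frac{\mu_1}{2}}\,\|(u(t),\partial_t u(t))\|_{\dot H^1\times L^2}=0\quad\text{if }\mu<0,$$ $$\lim_{t\to\infty}(1+t)^{-\frac12-\operatorname{Re}\nu+\frac{\mu_1}{2}}\|u(t)\|_{L^2}=0\quad\text{if }\mu\ne\tfrac14,$$ $$\lim_{t\to\infty}(1+t)^{-\frac12+\frac{\mu_1}{2}}\{1+\log(1+t)\}^{-1}\|u(t)\|_{L^2}=0\quad\text{if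 }\mu=\tfrac14.$$ -/

import Mathlib

open MeasureTheory TemperedDistribution Filter Set
open scoped FourierTransform SchwartzMap ENNReal Topology Laplacian

noncomputable section

/-- The Euclidean space `ℝᵈ`. -/
abbrev Rd (d : ℕ) : Type := EuclideanSpace ℝ (Fin d)

/-- The complex Lebesgue space `L²(ℝᵈ)`. -/
abbrev L2 (d : ℕ) : Type := Lp ℂ 2 (volume : Measure (Rd d))

/-- `f ∈ L²(ℝᵈ)` belongs to the inhomogeneous Sobolev space `H¹(ℝᵈ)`. -/
def MemH1 {d : ℕ} (f : L2 d) : Prop :=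
  MemSobolev 1 2 (f : 𝓢'(Rd d, ℂ))

/-- The homogeneous norm `‖f‖_{Ḣ¹} = ‖∇f‖_{L²} = ‖2π|ξ| f̂(ξ)‖_{L²_ξ}` of `f ∈ L²(ℝᵈ)`, with values
in `[0, ∞]`. Mathlib's Fourier transform is `f̂(ξ) = ∫ exp(-2πi x·ξ) f(x) dx`, hence the factor
`2π`. -/
def homH1Norm {d : ℕ} (f : L2 d) : ℝ≥0∞ :=
  eLpNorm (fun ξ : Rd d => ((2 * Real.pi * ‖ξ‖ : ℝ) : ℂ) * (𝓕 f : L2 d) ξ) 2 volume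

/-- The norm `(‖f‖_{Ḣ¹}² + ‖g‖_{L²}²)^{1/2}` of `Ḣ¹ × L²`. -/
def energyNorm {d : ℕ} (f g : L2 d) : ℝ≥0∞ :=
  (homH1Norm f ^ 2 + ‖g‖ₑ ^ 2) ^ (1 / 2 : ℝ)

/-- The time derivative `∂ₜu(t)` in `L²(ℝᵈ)` of a curve on `[0, ∞)` (one-sided at `t = 0`). -/
def timeDeriv {d : ℕ} (u : ℝ → L2 d) (t : ℝ) : L2 d :=
  derivWithin u (Ici 0) t

/-- `u ∈ C([0,∞); H¹(ℝᵈ)) ∩ C¹([0,∞); L²(ℝᵈ))` is a solution of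
`∂ₜ²u - Δu + μ₁/(1+t) ∂ₜu + μ₂/(1+t)² u = 0` on `(0,∞) × ℝᵈ`, `(u(0), ∂ₜu(0)) = (u₀, u₁)`,
the equation being understood in the sense of tempered distributions on `ℝᵈ` for every `t > 0`. -/
structure IsDWSolution (d : ℕ) (μ₁ μ₂ : ℝ) (u₀ u₁ : L2 d) (u : ℝ → L2 d) : Prop where
  memH1 : ∀ t, 0 ≤ t → MemH1 (u t)
  /-- `u` is continuously differentiable on `[0,∞)` with values in `L²`. -/
  contDiff : ContDiffOn ℝ 1 u (Ici 0)
  /-- `u` is continuous on `[0,∞)` for the `Ḣ¹` norm; with the `L²` continuity that is contained in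
  the previous field this is continuity with values in `H¹`. -/
  continuous_homH1 : ∀ t, 0 ≤ t →
    Tendsto (fun s => homH1Norm (u s - u t)) (𝓝[Ici 0] t) (𝓝 0)
  equation : ∀ t, 0 < t → ∀ φ : 𝓢(Rd d, ℂ),
    HasDerivAt (fun s => (timeDeriv u s : 𝓢'(Rd d, ℂ)) φ)
      ((Δ (u t : 𝓢'(Rd d, ℂ))) φ
        - ((μ₁ / (1 + t) : ℝ) : ℂ) * (timeDeriv u t : 𝓢'(Rd d, ℂ)) φ
        - ((μ₂ / (1 + t) ^ 2 : ℝ) : ℂ) * (u t : 𝓢'(Rd d, ℂ)) φ) t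
  initial : u 0 = u₀
  initial_deriv : timeDeriv u 0 = u₁

/-- Solutions of `∂ₜ²v - Δv + μ/(1+t)² v = 0`, `(v(0), ∂ₜv(0)) = (v₀, v₁)`: the equation above
without damping. -/
def IsKGSolution (d : ℕ) (μ : ℝ) (v₀ v₁ : L2 d) (v : ℝ → L2 d) : Prop :=
  IsDWSolution d 0 μ v₀ v₁ v

/-- The mass `μ = μ₁(2 - μ₁)/4 + μ₂`. -/
def massOf (μ₁ μ₂ : ℝ) : ℝ := μ₁ * (2 - μ₁) / 4 + μ₂

/-- `ν = ½ √(1 - 4μ)` for `μ ≤ 1/4` and `ν = (i/2) √(4μ - 1)` for `μ > 1/4`. -/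
def nu (μ : ℝ) : ℂ :=
  if μ ≤ 1 / 4 then (1 / 2 : ℂ) * (Real.sqrt (1 - 4 * μ) : ℂ)
  else (Complex.I / 2) * (Real.sqrt (4 * μ - 1) : ℂ)

end

/-! With `s = 1 + t`, the substitution `w(s) = s^(μ₁/2) u(s - 1)` removes the damping and leaves
`w'' - Δw + μ s⁻² w = 0`, so both halves of the theorem are one statement. On the Fourier side, cut
to a dyadic shell `|2πξ| ~ ρ = 2ⁿ`, this is an ODE in a Hilbert space, `w'' + B² w + μ s⁻² w = 0`,
with `B` comparable to `ρ`.

Two estimates of each shell are combined. At a fixed frequency the term `μ s⁻²` is an integrable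
perturbation of the oscillator, so the energy of that shell stays bounded (`exists_energy_bound`);
divided by a weight that tends to infinity, it tends to zero. This bound degenerates as `ρ → 0`, so
a second one, uniform in the shell, serves as a majorant: `‖w(s)‖ ≤ C h(s) D`, where `D` measures
the data in the shell and `h` is the dominant growth of the Euler equation `h'' + μ s⁻² h = 0`. The
`D` are square summable because the data lie in `H¹ × L²`, and dominated convergence over the shells
turns the uniform bound into decay to zero.

The uniform bound splits at `2ρs = 1`. Before that time `B²` is a perturbation of the Euler
equation: for `μ ≤ 1/4` reduction of order against a positive solution `h` works
(`innerBound_of_profile`), while for `μ > 1/4` Euler solutions oscillate and a scaling energy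
replaces it (`innerBound_of_quarter_lt`). Afterwards the energy grows by at most a factor depending
on `μ` (`outer_le`). For `μ < 0` the energy itself is controlled by `h(s)/s`, which then increases
to infinity. -/

open scoped RealInnerProductSpace

/-! ### Uniform bounds for the equation of one frequency shell. -/

section ShellFlow

variable {H : Type*} [NormedAddCommGroup H] [InnerProductSpace ℝ H]

/-- A solution `w`, with derivative `v`, of `w'' + B² w + μ s⁻² w = 0` on `[1, ∞)` in a Hilbert
space, where `B` is symmetric and comparable with the scalar `ρ` along `w`. -/
structure IsShellFlow (μ ρ : ℝ) (B : H →L[ℝ] H) (w v : ℝ → H) : Prop where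
  pos : 0 < ρ
  symm : ∀ x y, ⟪B x, y⟫ = ⟪x, B y⟫
  deriv_w : ∀ s, 1 ≤ s → HasDerivWithinAt w (v s) (Ici 1) s
  deriv_v : ∀ s, 1 ≤ s →
    HasDerivWithinAt v (-(B (B (w s))) - (μ / s ^ 2) • w s) (Ici 1) s
  lower : ∀ s, 1 ≤ s → ρ * ‖w s‖ ≤ ‖B (w s)‖
  upper : ∀ x, ‖B x‖ ≤ 2 * ρ * ‖x‖

/-- The size of the initial data of a flow. -/
def flowData (B : H →L[ℝ] H) (w v : ℝ → H) : ℝ := ‖w 1‖ + ‖v 1‖ + ‖B (w 1)‖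

/-- A positive solution `h` of the Euler equation `h'' + μ s⁻² h = 0`, together with a bounded
antiderivative `k` of `h⁻²`. -/
structure IsEulerProfile (μ : ℝ) (h h' k : ℝ → ℝ) (c K : ℝ) : Prop where
  deriv_h : ∀ s, 1 ≤ s → HasDerivAt h (h' s) s
  deriv_h' : ∀ s, 1 ≤ s → HasDerivAt h' (-(μ / s ^ 2) * h s) s
  deriv_k : ∀ s, 1 ≤ s → HasDerivAt k (1 / h s ^ 2) s
  one : h 1 = 1
  nonneg_h' : ∀ s, 1 ≤ s → 0 ≤ h' s
  sqrt_le : ∀ s, 1 ≤ s → s ≤ h s ^ 2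
  h'_le : ∀ s, 1 ≤ s → s * h' s ≤ c * h s
  k_le : ∀ s, 1 ≤ s → k s - k 1 ≤ K

theorem antitoneOn_Icc_of_hasDerivWithinAt_Ici {f f' : ℝ → ℝ} {a b : ℝ}
    (hf : ∀ s ∈ Icc a b, HasDerivWithinAt f (f' s) (Ici a) s)
    (hf' : ∀ s ∈ Icc a b, f' s ≤ 0) : AntitoneOn f (Icc a b) := by
  refine antitoneOn_of_deriv_nonpos (convex_Icc a b)
    (fun s hs => ((hf s hs).continuousWithinAt).mono Icc_subset_Ici_self) ?_ ?_
  · intro s hs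
    rw [interior_Icc] at hs
    exact ((hf s (Ioo_subset_Icc_self hs)).hasDerivAt
      (Ici_mem_nhds hs.1)).differentiableAt.differentiableWithinAt
  · intro s hs
    rw [interior_Icc] at hs
    rw [((hf s (Ioo_subset_Icc_self hs)).hasDerivAt (Ici_mem_nhds hs.1)).deriv]
    exact hf' s (Ioo_subset_Icc_self hs)

namespace IsEulerProfile

variable {μ c K : ℝ} {h h' k : ℝ → ℝ}

theorem mono (hp : IsEulerProfile μ h h' k c K) : MonotoneOn h (Ici 1) := by
  refine monotoneOn_of_deriv_nonneg (convex_Ici 1)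
    (fun s hs => (hp.deriv_h s hs).continuousAt.continuousWithinAt) ?_ ?_
  · intro s hs
    exact (hp.deriv_h s (interior_subset hs)).differentiableAt.differentiableWithinAt
  · intro s hs
    rw [(hp.deriv_h s (interior_subset hs)).deriv]
    exact hp.nonneg_h' s (interior_subset hs)

theorem one_le (hp : IsEulerProfile μ h h' k c K) {s : ℝ} (hs : 1 ≤ s) : 1 ≤ h s :=
  hp.one ▸ hp.mono (mem_Ici.2 le_rfl) hs hs

theorem c_nonneg (hp : IsEulerProfile μ h h' k c K) : 0 ≤ c := by
  have h1 := hp.h'_le 1 le_rfl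
  have h2 := hp.nonneg_h' 1 le_rfl
  rw [hp.one] at h1
  linarith

theorem K_nonneg (hp : IsEulerProfile μ h h' k c K) : 0 ≤ K := by
  simpa using hp.k_le 1 le_rfl

end IsEulerProfile

namespace IsShellFlow

variable {μ ρ : ℝ} {B : H →L[ℝ] H} {w v : ℝ → H}

theorem norm_sq_le (hw : IsShellFlow μ ρ B w v) (x : H) : ‖B (B x)‖ ≤ 4 * ρ ^ 2 * ‖x‖ := by
  have h1 := hw.upper (B x)
  have h2 := mul_le_mul_of_nonneg_left (hw.upper x) (by linarith [hw.pos] : 0 ≤ 2 * ρ)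
  linarith

theorem hasDerivWithinAt_energy (hw : IsShellFlow μ ρ B w v) {s : ℝ} (hs : 1 ≤ s) :
    HasDerivWithinAt (fun s => ‖v s‖ ^ 2 + ‖B (w s)‖ ^ 2)
      (-(2 * (μ / s ^ 2) * ⟪v s, w s⟫)) (Ici 1) s := by
  have h1 := (hw.deriv_v s hs).norm_sq
  have h2 := (B.hasFDerivAt.comp_hasDerivWithinAt s (hw.deriv_w s hs)).norm_sq
  refine (h1.add h2).congr_deriv ?_
  simp only [inner_sub_right, inner_neg_right, inner_smul_right, Function.comp_apply]
  rw [← hw.symm (v s), real_inner_comm (B (v s))]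
  ring

/-- Gronwall: the lower bound of `B` along `w` turns `2‖v‖‖w‖` into at most energy over `ρ`, so the
energy `E` satisfies `E' ≤ |μ| ρ⁻¹ s⁻² E`. The rate is integrable, with integral at most `|μ|/(ρa)`
over `[a, ∞)`. -/
theorem energy_mul_exp_le (hw : IsShellFlow μ ρ B w v) {a s : ℝ} (ha : 1 ≤ a) (has : a ≤ s) :
    ‖v s‖ ^ 2 + ‖B (w s)‖ ^ 2 ≤
      (‖v a‖ ^ 2 + ‖B (w a)‖ ^ 2) * Real.exp (|μ| / (ρ * a)) := by
  have hρ := hw.pos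
  have key : AntitoneOn
      (fun s => (‖v s‖ ^ 2 + ‖B (w s)‖ ^ 2) * Real.exp (|μ| / ρ * s⁻¹)) (Icc 1 s) := by
    refine antitoneOn_Icc_of_hasDerivWithinAt_Ici (f' := fun r =>
      (-(2 * (μ / r ^ 2) * ⟪v r, w r⟫)) * Real.exp (|μ| / ρ * r⁻¹) +
      (‖v r‖ ^ 2 + ‖B (w r)‖ ^ 2) * (Real.exp (|μ| / ρ * r⁻¹) * (|μ| / ρ * (-(r ^ 2)⁻¹))))
      ?_ ?_
    · intro r hr
      have hr0 : r ≠ 0 := by linarith [hr.1]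
      exact (hw.hasDerivWithinAt_energy hr.1).mul
        (((hasDerivAt_inv hr0).const_mul _).exp.hasDerivWithinAt)
    · intro r hr
      have hr0 : 0 < r := by linarith [hr.1]
      have h1 : |⟪v r, w r⟫| ≤ ‖v r‖ * ‖w r‖ := abs_real_inner_le_norm _ _
      have h2 : -(μ * ⟪v r, w r⟫) ≤ |μ| * (‖v r‖ * ‖w r‖) := by
        refine (neg_le_abs _).trans ?_
        rw [abs_mul]
        gcongr
      have h3 : 2 * (‖v r‖ * ‖w r‖) ≤ (‖v r‖ ^ 2 + ‖B (w r)‖ ^ 2) / ρ := by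
        rw [le_div_iff₀ hρ]
        have := mul_le_mul_of_nonneg_left (hw.lower r hr.1) (norm_nonneg (v r))
        nlinarith [sq_nonneg (‖v r‖ - ‖B (w r)‖)]
      have h4 : -(2 * (μ * ⟪v r, w r⟫)) - |μ| * ((‖v r‖ ^ 2 + ‖B (w r)‖ ^ 2) / ρ) ≤ 0 := by
        have := mul_le_mul_of_nonneg_left h3 (abs_nonneg μ)
        linarith
      have h5 := mul_nonpos_of_nonneg_of_nonpos
        (by positivity : 0 ≤ Real.exp (|μ| / ρ * r⁻¹) * (r ^ 2)⁻¹) h4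
      refine le_of_eq_of_le ?_ h5
      field_simp
      ring
  have h1 := key ⟨ha, has⟩ ⟨ha.trans has, le_rfl⟩ has
  have hs0 : 0 < s := by linarith
  have h2 : 1 ≤ Real.exp (|μ| / ρ * s⁻¹) := Real.one_le_exp (by positivity)
  have h3 : |μ| / (ρ * a) = |μ| / ρ * a⁻¹ := by
    have : 0 < a := by linarith
    field_simp
  rw [h3]
  refine le_trans ?_ h1
  exact le_mul_of_one_le_right (by positivity) h2

theorem flowData_nonneg : 0 ≤ flowData B w v := by
  unfold flowData; positivity

/-- Outside of the zone `2ρs ≤ 1` the energy is bounded by its value at the entrance. -/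
theorem outer_le (hw : IsShellFlow μ ρ B w v) {a s : ℝ} (ha : 1 ≤ a) (has : a ≤ s)
    (hρa : 1 ≤ 2 * ρ * a) :
    ‖v s‖ + ‖B (w s)‖ ≤ 2 * Real.exp |μ| * (‖v a‖ + ‖B (w a)‖) := by
  have h1 := hw.energy_mul_exp_le ha has
  have hρ := hw.pos
  have ha0 : 0 < a := by linarith
  have h2 : |μ| / (ρ * a) ≤ 2 * |μ| := by
    rw [div_le_iff₀ (by positivity)]
    nlinarith [abs_nonneg μ]
  -- The exponential is written as a square because the final inequality is proved by comparing
  -- squares.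
  have h3 : Real.exp (|μ| / (ρ * a)) ≤ Real.exp |μ| ^ 2 := by
    rw [← Real.exp_nat_mul]
    exact Real.exp_le_exp.2 (by push_cast; exact h2)
  have h4 : ‖v s‖ ^ 2 + ‖B (w s)‖ ^ 2 ≤ (‖v a‖ ^ 2 + ‖B (w a)‖ ^ 2) * Real.exp |μ| ^ 2 :=
    h1.trans (by gcongr)
  refine le_of_sq_le_sq ?_ (by positivity)
  have h5 : ‖v a‖ ^ 2 + ‖B (w a)‖ ^ 2 ≤ (‖v a‖ + ‖B (w a)‖) ^ 2 := by
    nlinarith [norm_nonneg (v a), norm_nonneg (B (w a)),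
      mul_nonneg (norm_nonneg (v a)) (norm_nonneg (B (w a)))]
  have h6 := mul_le_mul_of_nonneg_right h5 (sq_nonneg (Real.exp |μ|))
  nlinarith [sq_nonneg (‖v s‖ - ‖B (w s)‖), sq_nonneg (Real.exp |μ| * (‖v a‖ + ‖B (w a)‖))]

/-- Bounds in the zone `2ρs ≤ 1`. -/
def InnerBound (ρ : ℝ) (B : H →L[ℝ] H) (w v : ℝ → H) (h : ℝ → ℝ) (C : ℝ) : Prop :=
  ∀ s, 1 ≤ s → 2 * ρ * s ≤ 1 →
    ‖w s‖ ≤ C * h s * flowData B w v ∧ s * ‖v s‖ ≤ C * h s * flowData B w v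

theorem InnerBound.mul_energy_le {h : ℝ → ℝ} {C : ℝ} (hw : IsShellFlow μ ρ B w v)
    (hin : InnerBound ρ B w v h C) {s : ℝ} (hs : 1 ≤ s) (hρs : 2 * ρ * s ≤ 1) :
    s * (‖v s‖ + ‖B (w s)‖) ≤ 2 * C * h s * flowData B w v := by
  obtain ⟨h1, h2⟩ := hin s hs hρs
  have h3 : s * ‖B (w s)‖ ≤ 1 * ‖w s‖ := by
    calc s * ‖B (w s)‖ ≤ s * (2 * ρ * ‖w s‖) := by gcongr; exact hw.upper _
      _ = (2 * ρ * s) * ‖w s‖ := by ring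
      _ ≤ 1 * ‖w s‖ := by gcongr
  linarith

/-- The entrance time into the outer zone, with the bound for the energy there. -/
theorem exists_entrance {h : ℝ → ℝ} {C : ℝ} (hw : IsShellFlow μ ρ B w v)
    (hC : 0 ≤ C) (hh : ∀ s, 1 ≤ s → 1 ≤ h s) (hin : InnerBound ρ B w v h C) {s : ℝ} (hs : 1 ≤ s)
    (hρs : ¬ 2 * ρ * s ≤ 1) :
    ∃ a, 1 ≤ a ∧ a ≤ s ∧ 1 ≤ 2 * ρ * a ∧
      a * (‖v a‖ + ‖B (w a)‖) ≤ (1 + 2 * C) * h a * flowData B w v := by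
  have hρ := hw.pos
  have hD : 0 ≤ flowData B w v := flowData_nonneg
  -- The entrance time is `max 1 (2ρ)⁻¹`: high shells are in the outer zone from the start and need
  -- only the data, low shells enter when `2ρa = 1`, where the inner bound still applies.
  rcases le_total 1 (2 * ρ) with h1 | h1
  · refine ⟨1, le_rfl, hs, by linarith, ?_⟩
    have h2 : ‖v 1‖ + ‖B (w 1)‖ ≤ flowData B w v := by
      unfold flowData; linarith [norm_nonneg (w 1)]
    have h3 : 1 ≤ (1 + 2 * C) * h 1 :=
      one_le_mul_of_one_le_of_one_le (by linarith) (hh 1 le_rfl)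
    nlinarith
  · have ha : 1 ≤ (2 * ρ)⁻¹ := (one_le_inv₀ (by positivity)).2 h1
    have hρa : 2 * ρ * (2 * ρ)⁻¹ = 1 := mul_inv_cancel₀ (by positivity)
    refine ⟨(2 * ρ)⁻¹, ha, ?_, hρa.ge, ?_⟩
    · rw [inv_le_iff_one_le_mul₀ (by positivity)]
      linarith
    · refine (hin.mul_energy_le hw ha hρa.le).trans ?_
      have h4 : 0 ≤ h (2 * ρ)⁻¹ := by linarith [hh _ ha]
      gcongr
      linarith

/-- In the outer zone `‖w‖ ≤ ρ⁻¹ ‖B w‖ ≤ 2a ‖B w‖`; the factor `a` is exactly what the energy bound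
at the entrance `a` absorbs, and monotonicity of `h` moves the bound from `a` to `s`. -/
theorem norm_le_of_innerBound {h : ℝ → ℝ} {C : ℝ} (hw : IsShellFlow μ ρ B w v)
    (hC : 0 ≤ C) (hh : ∀ s, 1 ≤ s → 1 ≤ h s) (hmono : MonotoneOn h (Ici 1))
    (hin : InnerBound ρ B w v h C) {s : ℝ} (hs : 1 ≤ s) :
    ‖w s‖ ≤ 4 * Real.exp |μ| * (1 + 2 * C) * h s * flowData B w v := by
  have hρ := hw.pos
  have hD : 0 ≤ flowData B w v := flowData_nonneg
  have hhs := hh s hs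
  have hexp : 1 ≤ Real.exp |μ| := Real.one_le_exp (abs_nonneg μ)
  by_cases hρs : 2 * ρ * s ≤ 1
  · refine (hin s hs hρs).1.trans ?_
    gcongr
    nlinarith
  · obtain ⟨a, ha, has, hρa, hNa⟩ := exists_entrance hw hC hh hin hs hρs
    have h1 := hw.outer_le ha has hρa
    have h2 := hw.lower s hs
    have h3 : ‖w s‖ ≤ 2 * a * ‖B (w s)‖ := by
      calc ‖w s‖ ≤ (2 * ρ * a) * ‖w s‖ := le_mul_of_one_le_left (norm_nonneg _) hρa
        _ = 2 * a * (ρ * ‖w s‖) := by ring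
        _ ≤ 2 * a * ‖B (w s)‖ := by gcongr
    have h4 : h a ≤ h s := hmono ha hs has
    calc ‖w s‖ ≤ 2 * a * (‖v s‖ + ‖B (w s)‖) := h3.trans (by gcongr; linarith [norm_nonneg (v s)])
      _ ≤ 2 * a * (2 * Real.exp |μ| * (‖v a‖ + ‖B (w a)‖)) := by gcongr
      _ = 4 * Real.exp |μ| * (a * (‖v a‖ + ‖B (w a)‖)) := by ring
      _ ≤ 4 * Real.exp |μ| * ((1 + 2 * C) * h a * flowData B w v) := by gcongr
      _ ≤ 4 * Real.exp |μ| * ((1 + 2 * C) * h s * flowData B w v) := by gcongr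
      _ = _ := by ring

theorem energy_le_of_innerBound {h : ℝ → ℝ} {C : ℝ} (hw : IsShellFlow μ ρ B w v)
    (hC : 0 ≤ C) (hh : ∀ s, 1 ≤ s → 1 ≤ h s)
    (hmono : MonotoneOn (fun s => h s / s) (Ici 1))
    (hin : InnerBound ρ B w v h C) {s : ℝ} (hs : 1 ≤ s) :
    ‖v s‖ + ‖B (w s)‖ ≤ 2 * Real.exp |μ| * (1 + 2 * C) * (h s / s) * flowData B w v := by
  have hρ := hw.pos
  have hD : 0 ≤ flowData B w v := flowData_nonneg
  have hhs := hh s hs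
  have hs0 : 0 < s := by linarith
  have hexp : 1 ≤ Real.exp |μ| := Real.one_le_exp (abs_nonneg μ)
  by_cases hρs : 2 * ρ * s ≤ 1
  · have h1 := hin.mul_energy_le hw hs hρs
    have h2 : ‖v s‖ + ‖B (w s)‖ ≤ 2 * C * (h s / s) * flowData B w v := by
      rw [← mul_le_mul_iff_of_pos_left hs0]
      refine h1.trans_eq ?_
      field_simp
    refine h2.trans ?_
    have h3 : 2 * C ≤ 2 * Real.exp |μ| * (1 + 2 * C) := by nlinarith
    gcongr
  · obtain ⟨a, ha, has, hρa, hNa⟩ := exists_entrance hw hC hh hin hs hρs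
    have ha0 : 0 < a := by linarith
    have h1 := hw.outer_le ha has hρa
    have h4 : h a / a ≤ h s / s := hmono ha hs has
    have h5 : ‖v a‖ + ‖B (w a)‖ ≤ (1 + 2 * C) * (h a / a) * flowData B w v := by
      rw [← mul_le_mul_iff_of_pos_left ha0]
      refine hNa.trans_eq ?_
      field_simp
    calc ‖v s‖ + ‖B (w s)‖ ≤ 2 * Real.exp |μ| * (‖v a‖ + ‖B (w a)‖) := h1
      _ ≤ 2 * Real.exp |μ| * ((1 + 2 * C) * (h a / a) * flowData B w v) := by gcongr
      _ ≤ 2 * Real.exp |μ| * ((1 + 2 * C) * (h s / s) * flowData B w v) := by gcongr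
      _ = _ := by ring

theorem exists_energy_bound (hw : IsShellFlow μ ρ B w v) :
    ∃ A, ∀ s, 1 ≤ s → ‖w s‖ ≤ A ∧ ‖v s‖ ≤ A ∧ ‖B (w s)‖ ≤ A := by
  set E := (‖v 1‖ ^ 2 + ‖B (w 1)‖ ^ 2) * Real.exp (|μ| / (ρ * 1)) with hE
  have hρ := hw.pos
  refine ⟨Real.sqrt E + Real.sqrt E / ρ, fun s hs => ?_⟩
  have h1 := hw.energy_mul_exp_le le_rfl hs
  have h2 : ‖v s‖ ≤ Real.sqrt E := Real.le_sqrt_of_sq_le (by nlinarith [sq_nonneg ‖B (w s)‖])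
  have h3 : ‖B (w s)‖ ≤ Real.sqrt E := Real.le_sqrt_of_sq_le (by nlinarith [sq_nonneg ‖v s‖])
  have h4 : ‖w s‖ ≤ Real.sqrt E / ρ := by
    rw [le_div_iff₀ hρ]
    linarith [hw.lower s hs]
  have h5 : 0 ≤ Real.sqrt E / ρ := by positivity
  have h6 := Real.sqrt_nonneg E
  exact ⟨by linarith, by linarith, by linarith⟩

/-- Reduction of order: `z = w/h` satisfies `z' = N/h²` with the Wronskian `N = h v - h' w`, and `N'
= -h B² w` no longer contains `μ`. Boundedness of `k`, that is integrability of `h⁻²`, controls the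
part from `N 1`; the part from `B²` is small in the inner zone and is absorbed by the maximum of
`‖z‖`. -/
theorem innerBound_of_profile {h h' k : ℝ → ℝ} {c K : ℝ} (hw : IsShellFlow μ ρ B w v)
    (hp : IsEulerProfile μ h h' k c K) :
    InnerBound ρ B w v h ((1 + c) * (1 + 2 * (1 + K * (1 + c))) + 2 * (1 + K * (1 + c))) := by
  intro S hS hρS
  have hρ := hw.pos
  have hc := hp.c_nonneg
  have hK := hp.K_nonneg
  have hS0 : 0 < S := by linarith
  have hwc : ContinuousOn w (Icc 1 S) := fun s hs =>
    ((hw.deriv_w s hs.1).continuousWithinAt).mono Icc_subset_Ici_self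
  have hhc : ContinuousOn h (Icc 1 S) := fun s hs =>
    (hp.deriv_h s hs.1).continuousAt.continuousWithinAt
  have hpos : ∀ s, 1 ≤ s → 0 < h s := fun s hs => by linarith [hp.one_le hs]
  set N : ℝ → H := fun s => h s • v s - h' s • w s with hN
  set z : ℝ → H := fun s => (h s)⁻¹ • w s with hz
  have hzc : ContinuousOn z (Icc 1 S) :=
    (hhc.inv₀ fun s hs => (hpos s hs.1).ne').smul hwc
  obtain ⟨m, hm, hmax⟩ := isCompact_Icc.exists_isMaxOn (nonempty_Icc.2 hS) hzc.norm
  set M := ‖z m‖ with hM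
  have hM0 : 0 ≤ M := norm_nonneg _
  have hzM : ∀ s ∈ Icc 1 S, ‖w s‖ ≤ M * h s := by
    intro s hs
    have h1 : ‖z s‖ ≤ M := hmax hs
    have h2 := hpos s hs.1
    rw [hz] at h1
    simp only [norm_smul, norm_inv, Real.norm_eq_abs, abs_of_pos h2] at h1
    rwa [inv_mul_le_iff₀ h2, mul_comm] at h1
  have hNd : ∀ s, 1 ≤ s → HasDerivWithinAt N (-(h s • B (B (w s)))) (Ici 1) s := by
    intro s hs
    have h1 := ((hp.deriv_h s hs).hasDerivWithinAt (s := Ici 1)).smul (hw.deriv_v s hs)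
    have h2 := ((hp.deriv_h' s hs).hasDerivWithinAt (s := Ici 1)).smul (hw.deriv_w s hs)
    refine (h1.sub h2).congr_deriv ?_
    module
  have hNle : ∀ s ∈ Icc 1 S, ‖N s‖ ≤ ‖N 1‖ + 4 * ρ ^ 2 * M * s * h s ^ 2 := by
    intro s hs
    have h1 : ‖N s - N 1‖ ≤ (4 * ρ ^ 2 * M * h s ^ 2) * (s - 1) := by
      refine norm_image_sub_le_of_norm_deriv_le_segment'
        (f' := fun r => -(h r • B (B (w r)))) (a := 1) (b := s) ?_ ?_ s ⟨hs.1, le_rfl⟩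
      · exact fun r hr => (hNd r hr.1).mono Icc_subset_Ici_self
      · intro r hr
        have h2 := hpos r hr.1
        have h3 : h r ≤ h s := hp.mono hr.1 hs.1 hr.2.le
        rw [norm_neg, norm_smul, Real.norm_eq_abs, abs_of_pos h2]
        calc h r * ‖B (B (w r))‖ ≤ h r * (4 * ρ ^ 2 * (M * h r)) := by
              gcongr
              refine (hw.norm_sq_le _).trans ?_
              gcongr
              exact hzM r ⟨hr.1, hr.2.le.trans hs.2⟩
          _ = 4 * ρ ^ 2 * M * h r ^ 2 := by ring
          _ ≤ 4 * ρ ^ 2 * M * h s ^ 2 := by gcongr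
    have h2 : ‖N s‖ ≤ ‖N 1‖ + ‖N s - N 1‖ := by
      simpa using norm_add_le (N 1) (N s - N 1)
    have h3 : (4 * ρ ^ 2 * M * h s ^ 2) * (s - 1) ≤ 4 * ρ ^ 2 * M * s * h s ^ 2 := by
      have : 0 ≤ 4 * ρ ^ 2 * M * h s ^ 2 := by positivity
      nlinarith
    linarith
  have hzd : ∀ s, 1 ≤ s → HasDerivWithinAt z ((h s ^ 2)⁻¹ • N s) (Ici 1) s := by
    intro s hs
    have h0 := (hpos s hs).ne'
    have h1 := (((hp.deriv_h s hs).inv h0).hasDerivWithinAt (s := Ici 1)).smul (hw.deriv_w s hs)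
    refine h1.congr_deriv ?_
    rw [hN]
    simp only [smul_sub, smul_smul, Pi.inv_apply]
    have h2 : (h s ^ 2)⁻¹ * h s = (h s)⁻¹ := by field_simp
    rw [h2, neg_div, neg_smul, ← sub_eq_add_neg, div_eq_inv_mul]
  -- Divided by `h²`, the bound `hNle` becomes `‖z'‖ ≤ ‖N 1‖ h⁻² + 4ρ² M s`, whose antiderivative is
  -- explicit.
  have hzle : ‖z m‖ ≤ ‖z 1‖ + ‖N 1‖ * (k m - k 1) + 2 * ρ ^ 2 * M * (m ^ 2 - 1) := by
    refine image_norm_le_of_norm_deriv_right_le_deriv_boundary' (a := 1) (b := m)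
      (f' := fun s => (h s ^ 2)⁻¹ • N s)
      (B := fun s => ‖z 1‖ + ‖N 1‖ * (k s - k 1) + 2 * ρ ^ 2 * M * (s ^ 2 - 1))
      (B' := fun s => ‖N 1‖ * (1 / h s ^ 2) + 2 * ρ ^ 2 * M * (2 * s))
      (hzc.mono (Icc_subset_Icc_right hm.2)) ?_ ?_ ?_ ?_ ?_ ⟨hm.1, le_rfl⟩
    · exact fun s hs => (hzd s hs.1).mono (Ici_subset_Ici.2 hs.1)
    · simp
    · intro s hs
      refine ContinuousAt.continuousWithinAt ?_
      have := (hp.deriv_k s hs.1).continuousAt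
      fun_prop
    · intro s hs
      refine HasDerivAt.hasDerivWithinAt ?_
      have h1 := (((hp.deriv_k s hs.1).sub_const (k 1)).const_mul ‖N 1‖).const_add ‖z 1‖
      have h2 := ((hasDerivAt_pow 2 s).sub_const 1).const_mul (2 * ρ ^ 2 * M)
      refine (h1.add h2).congr_deriv ?_
      simp
    · intro s hs
      have h1 := hNle s ⟨hs.1, hs.2.le.trans hm.2⟩
      have h2 := hpos s hs.1
      rw [norm_smul, norm_inv, norm_pow, Real.norm_eq_abs, abs_of_pos h2,
        inv_mul_le_iff₀ (by positivity)]
      refine h1.trans_eq ?_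
      field_simp
      ring
  have hz1 : ‖z 1‖ = ‖w 1‖ := by simp [hz, hp.one]
  have hh1 : h' 1 ≤ c := by simpa [hp.one] using hp.h'_le 1 le_rfl
  set D := flowData B w v with hD
  have hD0 : 0 ≤ D := flowData_nonneg
  have hw1 : ‖w 1‖ ≤ D := by
    rw [hD, flowData]; linarith [norm_nonneg (v 1), norm_nonneg (B (w 1))]
  have hv1 : ‖v 1‖ ≤ D := by
    rw [hD, flowData]; linarith [norm_nonneg (w 1), norm_nonneg (B (w 1))]
  have hN1 : ‖N 1‖ ≤ (1 + c) * D := by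
    have h1 : ‖N 1‖ ≤ ‖v 1‖ + h' 1 * ‖w 1‖ := by
      have := norm_sub_le (h 1 • v 1) (h' 1 • w 1)
      simpa [hN, norm_smul, hp.one, abs_of_nonneg (hp.nonneg_h' 1 le_rfl)] using this
    have h2 : h' 1 * ‖w 1‖ ≤ c * D := by gcongr
    linarith
  have hMle : M ≤ 2 * (1 + K * (1 + c)) * D := by
    -- The absorption: `2ρm ≤ 1` leaves at most half of `M` on the right-hand side.
    have h1 : 2 * ρ ^ 2 * M * (m ^ 2 - 1) ≤ M / 2 := by
      have h2 : 2 * ρ * m ≤ 1 := le_trans (by gcongr; exact hm.2) hρS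
      have hm0 : 0 < m := by linarith [hm.1]
      have h3 : (2 * ρ * m) ^ 2 ≤ 1 := by
        have : 0 ≤ 2 * ρ * m := by positivity
        nlinarith
      nlinarith [mul_nonneg hM0 (sq_nonneg ρ), mul_le_mul_of_nonneg_left h3 hM0]
    have h2 : ‖N 1‖ * (k m - k 1) ≤ (1 + c) * D * K := by
      calc ‖N 1‖ * (k m - k 1) ≤ ‖N 1‖ * K := by gcongr; exact hp.k_le m hm.1
        _ ≤ (1 + c) * D * K := by gcongr
    nlinarith
  have hhS := hp.one_le hS
  have hhS0 := hpos S hS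
  have hSS : S ∈ Icc 1 S := ⟨hS, le_rfl⟩
  constructor
  · refine (hzM S hSS).trans ?_
    calc M * h S ≤ 2 * (1 + K * (1 + c)) * D * h S := by gcongr
      _ = 2 * (1 + K * (1 + c)) * h S * D := by ring
      _ ≤ _ := by
        gcongr
        have : 0 ≤ (1 + c) * (1 + 2 * (1 + K * (1 + c))) := by positivity
        linarith
  · have h1 : h S • v S = N S + h' S • w S := by simp [hN]
    have h2 : h S * ‖v S‖ ≤ ‖N S‖ + h' S * ‖w S‖ := by
      have := norm_add_le (N S) (h' S • w S)
      rw [← h1, norm_smul, norm_smul, Real.norm_eq_abs, Real.norm_eq_abs, abs_of_pos hhS0,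
        abs_of_nonneg (hp.nonneg_h' S hS)] at this
      exact this
    have h3 : S * ‖N S‖ ≤ h S ^ 2 * ((1 + c) * D + M) := by
      have h4 := hNle S hSS
      have h5 : S * ‖N 1‖ ≤ h S ^ 2 * ((1 + c) * D) :=
        mul_le_mul (hp.sqrt_le S hS) hN1 (norm_nonneg _) (by positivity)
      have h6 : (2 * ρ * S) ^ 2 ≤ 1 := by
        have : 0 ≤ 2 * ρ * S := by positivity
        nlinarith
      have h7 := mul_le_mul_of_nonneg_left h6 (by positivity : 0 ≤ h S ^ 2 * M)
      nlinarith [mul_le_mul_of_nonneg_left h4 hS0.le]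
    have h4 : S * (h' S * ‖w S‖) ≤ h S ^ 2 * (c * M) := by
      calc S * (h' S * ‖w S‖) = (S * h' S) * ‖w S‖ := by ring
        _ ≤ (c * h S) * (M * h S) :=
          mul_le_mul (hp.h'_le S hS) (hzM S hSS) (norm_nonneg _) (by positivity)
        _ = _ := by ring
    have h5 : S * ‖v S‖ ≤ h S * ((1 + c) * D + (1 + c) * M) := by
      rw [← mul_le_mul_iff_of_pos_left hhS0]
      nlinarith [mul_le_mul_of_nonneg_left h2 hS0.le]
    refine h5.trans ?_
    calc h S * ((1 + c) * D + (1 + c) * M)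
        ≤ h S * ((1 + c) * D + (1 + c) * (2 * (1 + K * (1 + c)) * D)) := by gcongr
      _ = ((1 + c) * (1 + 2 * (1 + K * (1 + c)))) * h S * D := by ring
      _ ≤ _ := by
        gcongr
        have : 0 ≤ 2 * (1 + K * (1 + c)) := by positivity
        linarith

end IsShellFlow

end ShellFlow

/-! ### Explicit solutions of the Euler equation for `μ ≤ 1/4`. -/

theorem isEulerProfile_rpow {ν : ℝ} (hν : 0 < ν) :
    IsEulerProfile (1 / 4 - ν ^ 2) (fun s => s ^ (1 / 2 + ν))
      (fun s => (1 / 2 + ν) * s ^ (ν - 1 / 2))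
      (fun s => -(s ^ (-(2 * ν)) / (2 * ν))) (1 / 2 + ν) (1 / (2 * ν)) where
  deriv_h s hs := by
    have h1 := Real.hasDerivAt_rpow_const (x := s) (p := 1 / 2 + ν) (Or.inl (by linarith))
    convert h1 using 3
    ring
  deriv_h' s hs := by
    have hs0 : 0 < s := by linarith
    have h1 := (Real.hasDerivAt_rpow_const (x := s) (p := ν - 1 / 2)
      (Or.inl hs0.ne')).const_mul (1 / 2 + ν)
    refine h1.congr_deriv ?_
    have h2 : s ^ (1 / 2 + ν) = s ^ (ν - 1 / 2 - 1) * s ^ 2 := by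
      rw [← Real.rpow_natCast, ← Real.rpow_add hs0]
      congr 1
      push_cast
      ring
    rw [h2]
    field_simp
    ring
  deriv_k s hs := by
    have hs0 : 0 < s := by linarith
    have h1 := ((Real.hasDerivAt_rpow_const (x := s) (p := -(2 * ν))
      (Or.inl hs0.ne')).div_const (2 * ν)).neg
    refine h1.congr_deriv ?_
    have h2 : 1 / (s ^ (1 / 2 + ν)) ^ 2 = s ^ (-(2 * ν) - 1) := by
      rw [← Real.rpow_natCast, ← Real.rpow_mul hs0.le, one_div, ← Real.rpow_neg hs0.le]
      congr 1
      push_cast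
      ring
    rw [h2]
    field_simp
  one := by simp
  nonneg_h' s hs := by positivity
  sqrt_le s hs := by
    have hs0 : 0 < s := by linarith
    rw [← Real.rpow_natCast, ← Real.rpow_mul hs0.le]
    exact Real.self_le_rpow_of_one_le hs (by push_cast; linarith)
  h'_le s hs := by
    have hs0 : 0 < s := by linarith
    have h2 : s ^ (1 / 2 + ν) = s ^ (ν - 1 / 2) * s := by
      rw [← Real.rpow_add_one hs0.ne']
      congr 1
      ring
    rw [h2]
    exact le_of_eq (by ring)
  k_le s hs := by
    have hs0 : 0 < s := by linarith
    have : 0 ≤ s ^ (-(2 * ν)) / (2 * ν) := by positivity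
    simp only [Real.one_rpow]
    linarith

/-- At the double root `s^(1/2)` is not admissible, since `1/s` has an unbounded antiderivative. The
factor `1 + log s` makes `h⁻² = 1/(s (1 + log s)²)` integrable and is the source of the logarithm in
the theorem. -/
theorem isEulerProfile_log :
    IsEulerProfile (1 / 4) (fun s => s ^ (1 / 2 : ℝ) * (1 + Real.log s))
      (fun s => s ^ (-(1 / 2) : ℝ) * (3 / 2 + Real.log s / 2))
      (fun s => -(1 + Real.log s)⁻¹) (3 / 2) 1 where
  deriv_h s hs := by
    have hs0 : 0 < s := by linarith
    have h1 := (Real.hasDerivAt_rpow_const (x := s) (p := (1 / 2 : ℝ)) (Or.inl hs0.ne')).mul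
      ((Real.hasDerivAt_log hs0.ne').const_add 1)
    refine h1.congr_deriv ?_
    have h2 : s ^ (1 / 2 : ℝ) = s ^ (-(1 / 2) : ℝ) * s := by
      rw [← Real.rpow_add_one hs0.ne']; norm_num
    have h3 : s ^ (1 / 2 - 1 : ℝ) = s ^ (-(1 / 2) : ℝ) := by norm_num
    rw [h2, h3]
    field_simp
    ring
  deriv_h' s hs := by
    have hs0 : 0 < s := by linarith
    have h1 := (Real.hasDerivAt_rpow_const (x := s) (p := (-(1 / 2) : ℝ)) (Or.inl hs0.ne')).mul
      (((Real.hasDerivAt_log hs0.ne').div_const 2).const_add (3 / 2))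
    refine h1.congr_deriv ?_
    have h2 : s ^ (1 / 2 : ℝ) = s ^ (-(1 / 2) - 1 : ℝ) * s ^ 2 := by
      rw [← Real.rpow_natCast, ← Real.rpow_add hs0]; norm_num
    have h3 : s ^ (-(1 / 2) : ℝ) = s ^ (-(1 / 2) - 1 : ℝ) * s := by
      rw [← Real.rpow_add_one hs0.ne']; norm_num
    rw [h2, h3]
    field_simp
    ring
  deriv_k s hs := by
    have hs0 : 0 < s := by linarith
    have hl : 0 < 1 + Real.log s := by linarith [Real.log_nonneg hs]
    have h1 := (((Real.hasDerivAt_log hs0.ne').const_add 1).inv hl.ne').neg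
    refine h1.congr_deriv ?_
    rw [mul_pow, ← Real.rpow_natCast (s ^ (1 / 2 : ℝ)), ← Real.rpow_mul hs0.le]
    norm_num
    field_simp
  one := by simp
  nonneg_h' s hs := by
    have := Real.log_nonneg hs
    positivity
  sqrt_le s hs := by
    have hs0 : 0 < s := by linarith
    have hl := Real.log_nonneg hs
    rw [mul_pow, ← Real.rpow_natCast (s ^ (1 / 2 : ℝ)), ← Real.rpow_mul hs0.le]
    norm_num
    exact le_mul_of_one_le_right hs0.le (one_le_pow₀ (by linarith))
  h'_le s hs := by
    have hs0 : 0 < s := by linarith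
    have hl := Real.log_nonneg hs
    have h2 : s ^ (1 / 2 : ℝ) = s ^ (-(1 / 2) : ℝ) * s := by
      rw [← Real.rpow_add_one hs0.ne']; norm_num
    rw [h2]
    have : 0 ≤ s ^ (-(1 / 2) : ℝ) * s := by positivity
    nlinarith
  k_le s hs := by
    have hl := Real.log_nonneg hs
    have : 0 ≤ (1 + Real.log s)⁻¹ := by positivity
    simp only [Real.log_one]
    linarith

/-! ### The scaling energy for `μ > 1/4`. -/

section ShellFlow

variable {H : Type*} [NormedAddCommGroup H] [InnerProductSpace ℝ H]

namespace IsShellFlow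

variable {μ ρ : ℝ} {B : H →L[ℝ] H} {w v : ℝ → H}

/-- Pair the equation with the multiplier `2s v - w`. The quantity is conserved by the pure Euler
equation, so only the term from `B²` remains. -/
theorem hasDerivWithinAt_conformalEnergy (hw : IsShellFlow μ ρ B w v) {s : ℝ} (hs : 1 ≤ s) :
    HasDerivWithinAt
      (fun s => s * ‖v s‖ ^ 2 - ⟪w s, v s⟫ + μ * (‖w s‖ ^ 2 * s⁻¹) + s * ‖B (w s)‖ ^ 2)
      (2 * ‖B (w s)‖ ^ 2) (Ici 1) s := by
  have hs0 : s ≠ 0 := by linarith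
  have dw := hw.deriv_w s hs
  have dv := hw.deriv_v s hs
  have did := (hasDerivAt_id s).hasDerivWithinAt (s := Ici 1)
  have h1 := did.mul dv.norm_sq
  have h2 := dw.inner ℝ dv
  have h3 := (dw.norm_sq.mul ((hasDerivAt_inv hs0).hasDerivWithinAt)).const_mul μ
  have h4 := did.mul (B.hasFDerivAt.comp_hasDerivWithinAt s dw).norm_sq
  refine (((h1.sub h2).add h3).add h4).congr_deriv ?_
  simp only [inner_sub_right, inner_neg_right, inner_smul_right, Function.comp_apply, id]
  rw [← hw.symm (v s), ← hw.symm (w s), real_inner_comm (B (v s)), real_inner_comm (v s) (w s),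
    real_inner_self_eq_norm_sq, real_inner_self_eq_norm_sq, real_inner_self_eq_norm_sq]
  field_simp
  ring

/-- The condition `μ > 1/4` makes the scaling energy `Q` coercive, with `δ ‖w‖² ≤ s Q`. Hence `Q' =
2‖B w‖² ≤ (8ρ²/δ) s Q`, and Gronwall costs at most `exp (1/δ)` while `2ρs ≤ 1`. Since `‖w‖²` is
controlled by `s Q`, the growth is that of `√s`. -/
theorem innerBound_of_quarter_lt (hw : IsShellFlow μ ρ B w v) (hμ : 1 / 4 < μ) :
    InnerBound ρ B w v Real.sqrt
      (Real.sqrt ((2 + μ) * Real.exp (1 / (μ - 1 / 4)) * (2 + 2 / (μ - 1 / 4)))) := by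
  intro S hS hρS
  have hρ := hw.pos
  set δ := μ - 1 / 4 with hδ
  have hδ0 : 0 < δ := by linarith
  have hS0 : 0 < S := by linarith
  set Q : ℝ → ℝ := fun s =>
    s * ‖v s‖ ^ 2 - ⟪w s, v s⟫ + μ * (‖w s‖ ^ 2 * s⁻¹) + s * ‖B (w s)‖ ^ 2 with hQ
  -- completing the square: `Q ≥ (s ‖v‖ - ‖w‖ / 2)² / s + δ ‖w‖² / s`
  have hQlow : ∀ s, 1 ≤ s →
      (s * ‖v s‖ - ‖w s‖ / 2) ^ 2 + δ * ‖w s‖ ^ 2 ≤ s * Q s := by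
    intro s hs
    have hs0 : 0 < s := by linarith
    have h1 := real_inner_le_norm (w s) (v s)
    have h2 : s * Q s = (s * ‖v s‖) ^ 2 - s * ⟪w s, v s⟫ + μ * ‖w s‖ ^ 2
        + (s * ‖B (w s)‖) ^ 2 := by
      simp only [hQ]
      field_simp
    rw [h2]
    nlinarith [mul_le_mul_of_nonneg_left h1 hs0.le, sq_nonneg (s * ‖B (w s)‖)]
  have key : AntitoneOn (fun s => Q s * Real.exp (-(4 * ρ ^ 2 / δ * s ^ 2))) (Icc 1 S) := by
    refine antitoneOn_Icc_of_hasDerivWithinAt_Ici (f' := fun r =>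
      (2 * ‖B (w r)‖ ^ 2) * Real.exp (-(4 * ρ ^ 2 / δ * r ^ 2)) +
      Q r * (Real.exp (-(4 * ρ ^ 2 / δ * r ^ 2)) * (-(4 * ρ ^ 2 / δ * (2 * r))))) ?_ ?_
    · intro r hr
      have h1 := (((hasDerivAt_pow 2 r).const_mul (4 * ρ ^ 2 / δ)).neg).exp
      refine ((hw.hasDerivWithinAt_conformalEnergy hr.1).mul h1.hasDerivWithinAt).congr_deriv ?_
      simp [hQ]
    · intro r hr
      have h1 : δ * ‖w r‖ ^ 2 ≤ r * Q r := by
        nlinarith [hQlow r hr.1, sq_nonneg (r * ‖v r‖ - ‖w r‖ / 2)]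
      have h2 : ‖B (w r)‖ ^ 2 ≤ 4 * ρ ^ 2 * ‖w r‖ ^ 2 := by
        have := pow_le_pow_left₀ (norm_nonneg _) (hw.upper (w r)) 2
        linarith
      have h3 : ‖B (w r)‖ ^ 2 ≤ 4 * ρ ^ 2 / δ * (r * Q r) := by
        refine h2.trans ?_
        rw [div_mul_eq_mul_div, le_div_iff₀ hδ0]
        nlinarith [mul_le_mul_of_nonneg_left h1 (by positivity : 0 ≤ 4 * ρ ^ 2)]
      have h4 := mul_nonneg (Real.exp_pos (-(4 * ρ ^ 2 / δ * r ^ 2))).le (sub_nonneg.2 h3)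
      linarith
  set D := flowData B w v with hD
  have hD0 : 0 ≤ D := flowData_nonneg
  have hQ1 : Q 1 ≤ (2 + μ) * D ^ 2 := by
    have h1 := abs_real_inner_le_norm (w 1) (v 1)
    have h2 := neg_le_abs ⟪w 1, v 1⟫
    have a := norm_nonneg (w 1)
    have b := norm_nonneg (v 1)
    have c := norm_nonneg (B (w 1))
    simp only [hQ, hD, flowData]
    nlinarith [mul_nonneg a b, mul_nonneg b c, mul_nonneg a c]
  have hQS : Q S ≤ (2 + μ) * Real.exp (1 / δ) * D ^ 2 := by
    have h1 := key ⟨le_rfl, hS⟩ ⟨hS, le_rfl⟩ hS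
    have h2 : Real.exp (-(4 * ρ ^ 2 / δ * 1 ^ 2)) ≤ 1 := Real.exp_le_one_iff.2 (by
      rw [neg_nonpos]; positivity)
    have h3 : 4 * ρ ^ 2 / δ * S ^ 2 ≤ 1 / δ := by
      rw [div_mul_eq_mul_div]
      gcongr
      have : 0 ≤ 2 * ρ * S := by positivity
      nlinarith
    have h4 : (0 : ℝ) ≤ (2 + μ) * D ^ 2 := mul_nonneg (by linarith) (sq_nonneg D)
    have h5 : Q S * Real.exp (-(4 * ρ ^ 2 / δ * S ^ 2)) ≤ (2 + μ) * D ^ 2 := by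
      refine h1.trans ?_
      calc Q 1 * Real.exp (-(4 * ρ ^ 2 / δ * 1 ^ 2))
          ≤ ((2 + μ) * D ^ 2) * Real.exp (-(4 * ρ ^ 2 / δ * 1 ^ 2)) := by gcongr
        _ ≤ ((2 + μ) * D ^ 2) * 1 := by gcongr
        _ = _ := mul_one _
    have h6 : Q S = Q S * Real.exp (-(4 * ρ ^ 2 / δ * S ^ 2)) * Real.exp (4 * ρ ^ 2 / δ * S ^ 2) := by
      rw [mul_assoc, ← Real.exp_add]; simp
    rw [h6]
    calc _ ≤ (2 + μ) * D ^ 2 * Real.exp (4 * ρ ^ 2 / δ * S ^ 2) := by gcongr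
      _ ≤ (2 + μ) * D ^ 2 * Real.exp (1 / δ) := by gcongr
      _ = _ := by ring
  set A := (2 + μ) * Real.exp (1 / δ) with hA
  have hA0 : 0 ≤ A := mul_nonneg (by linarith) (Real.exp_pos _).le
  have hfin : ∀ x : ℝ, 0 ≤ x → x ^ 2 ≤ (2 + 2 / δ) * (S * Q S) →
      x ≤ Real.sqrt (A * (2 + 2 / δ)) * Real.sqrt S * D := by
    intro x hx hxQ
    refine le_of_sq_le_sq ?_ (by positivity)
    rw [mul_pow, mul_pow, Real.sq_sqrt (by positivity), Real.sq_sqrt hS0.le]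
    calc x ^ 2 ≤ (2 + 2 / δ) * (S * Q S) := hxQ
      _ ≤ (2 + 2 / δ) * (S * (A * D ^ 2)) := by gcongr
      _ = _ := by ring
  have hlow := hQlow S hS
  have h1 : δ * ‖w S‖ ^ 2 ≤ S * Q S := by
    nlinarith [sq_nonneg (S * ‖v S‖ - ‖w S‖ / 2)]
  have h2 : ‖w S‖ ^ 2 ≤ 1 / δ * (S * Q S) := by
    rw [div_mul_eq_mul_div, one_mul, le_div_iff₀ hδ0]
    linarith
  have h3 : 0 ≤ S * Q S := le_trans (by positivity) h1
  have h4 : 2 / δ = 2 * (1 / δ) := by ring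
  have h5 : 0 ≤ 1 / δ * (S * Q S) := by positivity
  refine ⟨hfin _ (norm_nonneg _) ?_, hfin _ (by positivity) ?_⟩
  · rw [h4]; linarith
  · have h6 : (S * ‖v S‖ - ‖w S‖ / 2) ^ 2 ≤ S * Q S := by
      nlinarith [mul_nonneg hδ0.le (sq_nonneg ‖w S‖)]
    rw [h4]
    -- With `x = S‖v S‖` and `y = ‖w S‖`, this is the identity `x² = 2(x - y/2)² + y²/2 - (x - y)²`.
    nlinarith [sq_nonneg (S * ‖v S‖ - ‖w S‖)]

end IsShellFlow

end ShellFlow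

/-! ### Real Fourier multipliers on `L²`, and passage from weak to strong derivatives. -/

noncomputable section

/-- Bounded measurable real functions of the frequency. -/
def IsBddSymbol {d : ℕ} (m : Rd d → ℝ) : Prop := Measurable m ∧ ∃ C, ∀ x, |m x| ≤ C

theorem IsBddSymbol.memLp {d : ℕ} {m : Rd d → ℝ} (hm : IsBddSymbol m) :
    MemLp (fun x => (m x : ℂ)) ∞ (volume : Measure (Rd d)) := by
  obtain ⟨h1, C, hC⟩ := hm
  refine memLp_top_of_bound (Complex.measurable_ofReal.comp h1).aestronglyMeasurable C
    (Eventually.of_forall fun x => ?_)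
  simpa using hC x

/-- Multiplication by a bounded measurable function on `L²`. -/
def symbolMul {d : ℕ} (m : Rd d → ℝ) (hm : IsBddSymbol m) : L2 d →L[ℝ] L2 d :=
  ((ContinuousLinearMap.mul ℂ ℂ).holderL (volume : Measure (Rd d)) ∞ 2 2
    (hm.memLp.toLp _)).restrictScalars ℝ

section symbolMul

variable {d : ℕ} {a b m : Rd d → ℝ}

theorem coeFn_symbolMul (hm : IsBddSymbol m) (f : L2 d) :
    symbolMul m hm f =ᵐ[volume] fun x => (m x : ℂ) * f x := by
  have h := (ContinuousLinearMap.mul ℂ ℂ).coeFn_holder (r := 2) (hm.memLp.toLp _) f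
  filter_upwards [h, hm.memLp.coeFn_toLp] with x h1 h2
  refine h1.trans ?_
  rw [h2, ContinuousLinearMap.mul_apply']

theorem symbolMul_symbolMul (ha : IsBddSymbol a) (hb : IsBddSymbol b) (hm : IsBddSymbol m)
    (h : ∀ x, a x * b x = m x) (f : L2 d) :
    symbolMul a ha (symbolMul b hb f) = symbolMul m hm f := by
  apply Lp.ext
  filter_upwards [coeFn_symbolMul ha (symbolMul b hb f), coeFn_symbolMul hb f,
    coeFn_symbolMul hm f] with x h1 h2 h3
  rw [h1, h2, h3, ← h x]
  push_cast
  ring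

theorem norm_symbolMul_le (hm : IsBddSymbol m) {C : ℝ} (hC : ∀ x, |m x| ≤ C) (f : L2 d) :
    ‖symbolMul m hm f‖ ≤ C * ‖f‖ := by
  refine Lp.norm_le_mul_norm_of_ae_le_mul ?_
  filter_upwards [coeFn_symbolMul hm f] with x hx
  rw [hx, norm_mul, Complex.norm_real, Real.norm_eq_abs]
  gcongr
  exact hC x

theorem mul_norm_symbolMul_le (ha : IsBddSymbol a) (hb : IsBddSymbol b) {C : ℝ}
    (hC : ∀ x, |a x| ≤ C * |b x|) (f : L2 d) :
    ‖symbolMul a ha f‖ ≤ C * ‖symbolMul b hb f‖ := by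
  refine Lp.norm_le_mul_norm_of_ae_le_mul ?_
  filter_upwards [coeFn_symbolMul ha f, coeFn_symbolMul hb f] with x h1 h2
  rw [h1, h2, norm_mul, norm_mul, Complex.norm_real, Complex.norm_real, Real.norm_eq_abs,
    Real.norm_eq_abs, ← mul_assoc]
  gcongr
  exact hC x

theorem symbolMul_symm (hm : IsBddSymbol m) (f g : L2 d) :
    ⟪symbolMul m hm f, g⟫ = ⟪f, symbolMul m hm g⟫ := by
  rw [L2.inner_def, L2.inner_def]
  refine integral_congr_ae ?_
  filter_upwards [coeFn_symbolMul hm f, coeFn_symbolMul hm g] with x h1 h2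
  rw [h1, h2, ← Complex.real_smul, ← Complex.real_smul, real_inner_smul_left,
    real_inner_smul_right]

theorem toTemperedDistribution_symbolMul (hm : IsBddSymbol m)
    (hg : (fun x => (m x : ℂ)).HasTemperateGrowth) (f : L2 d) :
    (symbolMul m hm f : 𝓢'(Rd d, ℂ)) = smulLeftCLM ℂ (fun x => (m x : ℂ)) (f : 𝓢'(Rd d, ℂ)) := by
  rw [← Lp.toTemperedDistribution_smul_eq (r := 2) hg hm.memLp f]
  congr 1

end symbolMul

/-- The pairing of an `L²` function with a Schwartz function. -/
def schwartzPairing {d : ℕ} (ψ : 𝓢(Rd d, ℂ)) : L2 d →L[ℂ] ℂ :=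
  PointwiseConvergenceCLM.evalCLM (RingHom.id ℂ) ℂ ψ ∘L
    Lp.toTemperedDistributionCLM ℂ (volume : Measure (Rd d)) 2

theorem schwartzPairing_apply {d : ℕ} (ψ : 𝓢(Rd d, ℂ)) (f : L2 d) :
    schwartzPairing ψ f = (f : 𝓢'(Rd d, ℂ)) ψ := rfl

theorem eq_zero_of_schwartzPairing {d : ℕ} {f : L2 d}
    (h : ∀ ψ : 𝓢(Rd d, ℂ), schwartzPairing ψ f = 0) : f = 0 := by
  have h1 := Lp.ker_toTemperedDistributionCLM_eq_bot (F := ℂ) (p := 2)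
    (μ := (volume : Measure (Rd d)))
  have h2 : f ∈ (Lp.toTemperedDistributionCLM ℂ (volume : Measure (Rd d)) 2).ker := by
    rw [LinearMap.mem_ker]
    ext ψ
    exact h ψ
  rw [h1] at h2
  exact (Submodule.mem_bot _).1 h2

theorem toTemperedDistribution_injective {d : ℕ} {f g : L2 d}
    (h : (f : 𝓢'(Rd d, ℂ)) = (g : 𝓢'(Rd d, ℂ))) : f = g := by
  rw [← sub_eq_zero]
  refine eq_zero_of_schwartzPairing fun ψ => ?_
  rw [map_sub, schwartzPairing_apply, schwartzPairing_apply, h, sub_self]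

theorem eq_of_hasDerivAt_zero {E : Type*} [NormedAddCommGroup E] [NormedSpace ℝ E] {f : ℝ → E}
    (hf : ContinuousOn f (Ici 0)) (hd : ∀ t, 0 < t → HasDerivAt f 0 t) {t : ℝ} (ht : 0 ≤ t) :
    f t = f 0 := by
  -- The derivative is known only for positive times; continuity at `0` supplies the one-sided
  -- derivative there.
  have h0 : HasDerivWithinAt f 0 (Ici 0) 0 := by
    refine hasDerivWithinAt_Ici_of_tendsto_deriv (s := Ioi 0)
      (fun s hs => (hd s hs).differentiableAt.differentiableWithinAt)
      ((hf 0 self_mem_Ici).mono Ioi_subset_Ici_self) self_mem_nhdsWithin ?_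
    refine tendsto_const_nhds.congr' ?_
    filter_upwards [self_mem_nhdsWithin] with s hs
    exact (hd s hs).deriv.symm
  refine constant_of_has_deriv_right_zero (a := 0) (b := t) (hf.mono Icc_subset_Ici_self) ?_ t
    ⟨ht, le_rfl⟩
  intro s hs
  rcases hs.1.eq_or_lt with h | h
  · rw [← h]; exact h0
  · exact (hd s h).hasDerivWithinAt

/-- A continuous curve in `L²` with a continuous derivative in the sense of distributions is
differentiable. -/
theorem hasDerivWithinAt_of_weak {d : ℕ} {F G : ℝ → L2 d} (hF : ContinuousOn F (Ici 0))
    (hG : ContinuousOn G (Ici 0))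
    (h : ∀ t, 0 < t → ∀ ψ : 𝓢(Rd d, ℂ),
      HasDerivAt (fun s => schwartzPairing ψ (F s)) (schwartzPairing ψ (G t)) t)
    {t : ℝ} (ht : 0 ≤ t) : HasDerivWithinAt F (G t) (Ici 0) t := by
  -- A continuous extension of `G` to the line, so that its primitive `I` is differentiable
  -- everywhere; `F - I` then has zero weak derivative.
  set g : ℝ → L2 d := fun s => G (max s 0) with hg
  have hgc : Continuous g :=
    hG.comp_continuous (by fun_prop) (fun s => le_max_right s 0)
  set I : ℝ → L2 d := fun s => ∫ r in (0 : ℝ)..s, g r with hI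
  have hId : ∀ s, HasDerivAt I (g s) s := fun s => hgc.integral_hasStrictDerivAt 0 s |>.hasDerivAt
  have hgG : ∀ s, 0 ≤ s → g s = G s := fun s hs => by simp [hg, hs]
  have hFI : ∀ s, 0 ≤ s → F s = F 0 + I s := by
    intro s hs
    have hz : F s - I s - F 0 = 0 := by
      refine eq_zero_of_schwartzPairing fun ψ => ?_
      have h1 : schwartzPairing ψ (F s - I s) = schwartzPairing ψ (F 0 - I 0) := by
        refine eq_of_hasDerivAt_zero (f := fun s => schwartzPairing ψ (F s - I s)) ?_ ?_ hs
        · refine (schwartzPairing ψ).continuous.comp_continuousOn (hF.sub ?_)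
          exact fun r _ => (hId r).continuousAt.continuousWithinAt
        · intro r hr
          have h2 := ((schwartzPairing ψ).restrictScalars ℝ).hasFDerivAt.comp_hasDerivAt r (hId r)
          have h3 := (h r hr ψ).sub h2
          simp only [ContinuousLinearMap.coe_restrictScalars', hgG r hr.le, sub_self] at h3
          refine h3.congr_of_eventuallyEq (Eventually.of_forall fun x => ?_)
          simp
      rw [map_sub, h1]
      simp [hI]
    rw [sub_sub, sub_eq_zero] at hz
    rw [hz, add_comm]
  have h4 := ((hId t).const_add (F 0)).hasDerivWithinAt (s := Ici 0)
  rw [hgG t ht] at h4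
  exact h4.congr (fun s hs => hFI s hs) (hFI t ht)

/-! ### Dyadic shells in frequency. -/

section shells

variable {d : ℕ}

/-- The dyadic shell `2ⁿ ≤ 2π‖ξ‖ < 2ⁿ⁺¹`. -/
def shell (d : ℕ) (n : ℤ) : Set (Rd d) :=
  {ξ | (2 : ℝ) ^ n ≤ 2 * Real.pi * ‖ξ‖ ∧ 2 * Real.pi * ‖ξ‖ < (2 : ℝ) ^ (n + 1)}

theorem measurableSet_shell (n : ℤ) : MeasurableSet (shell d n) :=
  (measurableSet_le measurable_const (measurable_norm.const_mul _)).inter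
    (measurableSet_lt (measurable_norm.const_mul _) measurable_const)

theorem isBddSymbol_indicator_shell (n : ℤ) {m : Rd d → ℝ} (hm : Continuous m) :
    IsBddSymbol ((shell d n).indicator m) := by
  refine ⟨hm.measurable.indicator (measurableSet_shell n), ?_⟩
  obtain ⟨C, hC⟩ := (isCompact_closedBall (0 : Rd d) ((2 : ℝ) ^ (n + 1))).exists_bound_of_continuousOn
    hm.continuousOn
  refine ⟨max C 0, fun x => ?_⟩
  by_cases hx : x ∈ shell d n
  · rw [indicator_of_mem hx]
    refine (hC x ?_).trans (le_max_left _ _)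
    rw [mem_closedBall_zero_iff]
    have h1 := hx.2
    have h2 := Real.pi_gt_three
    nlinarith [norm_nonneg x]
  · simp [indicator_of_notMem hx]

/-- The frequency localization to a dyadic shell. -/
def shellProj (d : ℕ) (n : ℤ) : L2 d →L[ℝ] L2 d :=
  symbolMul _ (isBddSymbol_indicator_shell n (m := fun _ => 1) continuous_const)

/-- The operator `√(-Δ)` on the Fourier side, localized to a dyadic shell. -/
def shellGrad (d : ℕ) (n : ℤ) : L2 d →L[ℝ] L2 d :=
  symbolMul _ (isBddSymbol_indicator_shell n (m := fun ξ => 2 * Real.pi * ‖ξ‖) (by fun_prop))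

theorem norm_shellGrad_le (n : ℤ) (f : L2 d) :
    ‖shellGrad d n f‖ ≤ 2 * (2 : ℝ) ^ n * ‖f‖ := by
  refine norm_symbolMul_le _ (fun x => ?_) f
  by_cases hx : x ∈ shell d n
  · rw [indicator_of_mem hx, abs_of_nonneg (by positivity)]
    have := hx.2
    rw [zpow_add_one₀ two_ne_zero] at this
    linarith
  · rw [indicator_of_notMem hx, abs_zero]
    positivity

theorem shellGrad_shellProj (n : ℤ) (f : L2 d) :
    shellGrad d n (shellProj d n f) = shellGrad d n f := by
  refine symbolMul_symbolMul _ _ _ (fun x => ?_) f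
  by_cases hx : x ∈ shell d n <;> simp [hx]

theorem le_norm_shellGrad (n : ℤ) (f : L2 d) :
    (2 : ℝ) ^ n * ‖shellProj d n f‖ ≤ ‖shellGrad d n (shellProj d n f)‖ := by
  rw [shellGrad_shellProj]
  have h := mul_norm_symbolMul_le
    (isBddSymbol_indicator_shell n (m := fun _ => 1) continuous_const)
    (isBddSymbol_indicator_shell n (m := fun ξ : Rd d => 2 * Real.pi * ‖ξ‖) (by fun_prop))
    (C := ((2 : ℝ) ^ n)⁻¹) (fun x => ?_) f
  · rw [← div_eq_inv_mul, le_div_iff₀ (by positivity)] at h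
    rw [mul_comm]
    exact h
  · by_cases hx : x ∈ shell d n
    · rw [indicator_of_mem hx, indicator_of_mem hx, abs_one, abs_of_nonneg (by positivity),
        ← div_eq_inv_mul, one_le_div₀ (by positivity)]
      exact hx.1
    · simp [hx]

end shells

/-! ### The resolvent symbol, which makes the Laplacian bounded. -/

section resolvent

variable (d : ℕ)

/-- The symbol `(1 + ‖ξ‖²)⁻¹`. -/
def resSymbol (ξ : Rd d) : ℝ := (1 + ‖ξ‖ ^ 2) ^ (-1 : ℝ)

/-- The symbol `‖ξ‖² (1 + ‖ξ‖²)⁻¹`. -/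
def resLapSymbol (ξ : Rd d) : ℝ := (1 + ‖ξ‖ ^ 2) ^ (-1 : ℝ) * ‖ξ‖ ^ 2

theorem isBddSymbol_resSymbol : IsBddSymbol (resSymbol d) := by
  refine ⟨by unfold resSymbol; fun_prop, 1, fun x => ?_⟩
  rw [resSymbol, Real.rpow_neg_one, abs_of_nonneg (by positivity)]
  exact inv_le_one_of_one_le₀ (by nlinarith [sq_nonneg ‖x‖])

theorem isBddSymbol_resLapSymbol : IsBddSymbol (resLapSymbol d) := by
  refine ⟨by unfold resLapSymbol; fun_prop, 1, fun x => ?_⟩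
  rw [resLapSymbol, Real.rpow_neg_one, abs_of_nonneg (by positivity), ← div_eq_inv_mul,
    div_le_one (by positivity)]
  linarith

theorem hasTemperateGrowth_resSymbol :
    (fun ξ => (resSymbol d ξ : ℂ)).HasTemperateGrowth := by
  unfold resSymbol
  fun_prop

theorem hasTemperateGrowth_resLapSymbol :
    (fun ξ => (resLapSymbol d ξ : ℂ)).HasTemperateGrowth := by
  unfold resLapSymbol
  fun_prop

variable {d}

/-- The smooth symbol acts on Schwartz functions, unlike the indicator of a shell. Testing against
the right-hand test function therefore reads the equation on the Fourier side with a resolvent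
applied. -/
theorem schwartzPairing_resSymbol (f : L2 d) (ψ : 𝓢(Rd d, ℂ)) :
    schwartzPairing ψ (symbolMul _ (isBddSymbol_resSymbol d) (𝓕 f)) =
      (f : 𝓢'(Rd d, ℂ)) (𝓕 (SchwartzMap.smulLeftCLM ℂ (fun ξ => (resSymbol d ξ : ℂ)) ψ)) := by
  rw [schwartzPairing_apply, toTemperedDistribution_symbolMul _ (hasTemperateGrowth_resSymbol d),
    ← Lp.fourier_toTemperedDistribution_eq, smulLeftCLM_apply_apply]
  exact TemperedDistribution.fourier_apply _ _

theorem schwartzPairing_resLapSymbol (f : L2 d) (ψ : 𝓢(Rd d, ℂ)) :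
    (Δ (f : 𝓢'(Rd d, ℂ))) (𝓕 (SchwartzMap.smulLeftCLM ℂ (fun ξ => (resSymbol d ξ : ℂ)) ψ)) =
      -(2 * Real.pi) ^ 2 *
        schwartzPairing ψ (symbolMul _ (isBddSymbol_resLapSymbol d) (𝓕 f)) := by
  have h1 : (fun ξ => (resLapSymbol d ξ : ℂ)) =
      (fun ξ : Rd d => ((‖ξ‖ ^ 2 : ℝ) : ℂ)) * (fun ξ => (resSymbol d ξ : ℂ)) := by
    ext ξ
    simp [resLapSymbol, resSymbol, mul_comm]
  rw [schwartzPairing_apply, toTemperedDistribution_symbolMul _ (hasTemperateGrowth_resLapSymbol d),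
    ← Lp.fourier_toTemperedDistribution_eq, h1,
    ← smulLeftCLM_smulLeftCLM_apply (by fun_prop) (hasTemperateGrowth_resSymbol d),
    smulLeftCLM_apply_apply, laplacian_eq_fourierMultiplierCLM]
  rw [show (-(2 * Real.pi) ^ 2 : ℂ) = ((-(2 * Real.pi) ^ 2 : ℝ) : ℂ) by push_cast; ring,
    ← Complex.real_smul, fourierMultiplierCLM_apply]
  refine congrArg (fun z : ℂ => (-(2 * Real.pi) ^ 2 : ℝ) • z) ?_
  refine (TemperedDistribution.fourierInv_apply _ _).trans ?_
  rw [FourierTransform.fourierInv_fourier_eq]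

end resolvent

/-! ### From the distributional equation to the shell equation. -/

section IsDWSolution

variable {d : ℕ} {μ₁ μ₂ : ℝ} {u₀ u₁ : L2 d} {u : ℝ → L2 d}

/-- The Fourier transform on `L²` as a real linear operator. -/
def fourierL2 (d : ℕ) : L2 d →L[ℝ] L2 d :=
  ((Lp.fourierTransformₗᵢ (Rd d) ℂ).toContinuousLinearEquiv : L2 d →L[ℂ] L2 d).restrictScalars ℝ

theorem fourierL2_apply (f : L2 d) : fourierL2 d f = 𝓕 f := rfl

theorem continuousOn_timeDeriv (hu : IsDWSolution d μ₁ μ₂ u₀ u₁ u) :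
    ContinuousOn (timeDeriv u) (Ici 0) :=
  hu.contDiff.continuousOn_derivWithin (uniqueDiffOn_Ici 0) le_rfl

theorem hasDerivWithinAt_timeDeriv (hu : IsDWSolution d μ₁ μ₂ u₀ u₁ u) {t : ℝ} (ht : 0 ≤ t) :
    HasDerivWithinAt u (timeDeriv u t) (Ici 0) t :=
  ((hu.contDiff.differentiableOn one_ne_zero) t ht).hasDerivWithinAt

theorem continuousOn_dampedForce {E : Type*} [NormedAddCommGroup E] [NormedSpace ℝ E] (c : ℝ)
    {a b : ℝ → ℝ} {f g h : ℝ → E} {s : Set ℝ} (ha : ContinuousOn a s) (hb : ContinuousOn b s)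
    (hf : ContinuousOn f s) (hg : ContinuousOn g s) (hh : ContinuousOn h s) :
    ContinuousOn (fun t => -(c • f t) - a t • g t - b t • h t) s :=
  (((hf.const_smul c).neg).sub (ha.smul hg)).sub (hb.smul hh)

/-- The equation holds in the strong sense after application of `(1 + ‖ξ‖²)⁻¹`. -/
theorem hasDerivWithinAt_resolvent (hu : IsDWSolution d μ₁ μ₂ u₀ u₁ u) {t : ℝ} (ht : 0 ≤ t) :
    HasDerivWithinAt
      (fun s => symbolMul _ (isBddSymbol_resSymbol d) (fourierL2 d (timeDeriv u s)))
      (-((2 * Real.pi) ^ 2 • symbolMul _ (isBddSymbol_resLapSymbol d) (fourierL2 d (u t)))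
        - (μ₁ / (1 + t)) • symbolMul _ (isBddSymbol_resSymbol d) (fourierL2 d (timeDeriv u t))
        - (μ₂ / (1 + t) ^ 2) • symbolMul _ (isBddSymbol_resSymbol d) (fourierL2 d (u t)))
      (Ici 0) t := by
  set R := symbolMul _ (isBddSymbol_resSymbol d) with hR
  set R' := symbolMul _ (isBddSymbol_resLapSymbol d) with hR'
  have hcu : ContinuousOn u (Ici 0) := hu.contDiff.continuousOn
  have hcv := continuousOn_timeDeriv hu
  have hc1 : ContinuousOn (fun s : ℝ => μ₁ / (1 + s)) (Ici 0) :=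
    continuousOn_const.div (by fun_prop) fun s (hs : 0 ≤ s) => by positivity
  have hc2 : ContinuousOn (fun s : ℝ => μ₂ / (1 + s) ^ 2) (Ici 0) :=
    continuousOn_const.div (by fun_prop) fun s (hs : 0 ≤ s) => by positivity
  have hRv : ContinuousOn (fun s => R (fourierL2 d (timeDeriv u s))) (Ici 0) :=
    R.continuous.comp_continuousOn ((fourierL2 d).continuous.comp_continuousOn hcv)
  have hRu : ContinuousOn (fun s => R (fourierL2 d (u s))) (Ici 0) :=
    R.continuous.comp_continuousOn ((fourierL2 d).continuous.comp_continuousOn hcu)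
  have hRu' : ContinuousOn (fun s => R' (fourierL2 d (u s))) (Ici 0) :=
    R'.continuous.comp_continuousOn ((fourierL2 d).continuous.comp_continuousOn hcu)
  have hG : ContinuousOn (fun t => -((2 * Real.pi) ^ 2 • R' (fourierL2 d (u t)))
        - (μ₁ / (1 + t)) • R (fourierL2 d (timeDeriv u t))
        - (μ₂ / (1 + t) ^ 2) • R (fourierL2 d (u t))) (Ici 0) :=
    continuousOn_dampedForce _ hc1 hc2 hRu' hRv hRu
  refine hasDerivWithinAt_of_weak
    (G := fun t => -((2 * Real.pi) ^ 2 • R' (fourierL2 d (u t)))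
        - (μ₁ / (1 + t)) • R (fourierL2 d (timeDeriv u t))
        - (μ₂ / (1 + t) ^ 2) • R (fourierL2 d (u t))) hRv hG ?_ ht
  intro t ht ψ
  have h := hu.equation t ht (𝓕 (SchwartzMap.smulLeftCLM ℂ (fun ξ => (resSymbol d ξ : ℂ)) ψ))
  rw [schwartzPairing_resLapSymbol, ← schwartzPairing_resSymbol, ← schwartzPairing_resSymbol] at h
  simp only [← schwartzPairing_resSymbol] at h
  refine h.congr_deriv ?_
  have hsm : ∀ (c : ℝ) (f : L2 d), schwartzPairing ψ (c • f) = (c : ℂ) * schwartzPairing ψ f := by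
    intro c f
    have := ((schwartzPairing ψ).restrictScalars ℝ).map_smul c f
    rw [Complex.real_smul] at this
    exact this
  simp only [map_sub, map_neg, hsm, fourierL2_apply, ← hR, ← hR']
  push_cast
  ring

/-- The equation of the localization of a solution to a dyadic shell. -/
theorem hasDerivWithinAt_shellProj_timeDeriv (hu : IsDWSolution d μ₁ μ₂ u₀ u₁ u) (n : ℤ) {t : ℝ}
    (ht : 0 ≤ t) :
    HasDerivWithinAt (fun s => shellProj d n (fourierL2 d (timeDeriv u s)))
      (-(shellGrad d n (shellGrad d n (shellProj d n (fourierL2 d (u t)))))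
        - (μ₁ / (1 + t)) • shellProj d n (fourierL2 d (timeDeriv u t))
        - (μ₂ / (1 + t) ^ 2) • shellProj d n (fourierL2 d (u t)))
      (Ici 0) t := by
  -- On a shell `1 + ‖ξ‖²` is bounded, so this multiplier undoes the resolvent and localizes at
  -- once.
  have hb := isBddSymbol_indicator_shell (d := d) n (m := fun ξ => 1 + ‖ξ‖ ^ 2) (by fun_prop)
  have hb' := isBddSymbol_indicator_shell (d := d) n (m := fun ξ => ‖ξ‖ ^ 2) (by fun_prop)
  have hinv : ∀ x : Rd d, (1 + ‖x‖ ^ 2) * (1 + ‖x‖ ^ 2) ^ (-1 : ℝ) = 1 := fun x => by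
    rw [Real.rpow_neg_one]
    exact mul_inv_cancel₀ (by positivity)
  have h1 : ∀ f, symbolMul _ hb (symbolMul _ (isBddSymbol_resSymbol d) f) = shellProj d n f := by
    refine symbolMul_symbolMul _ _ _ fun x => ?_
    by_cases hx : x ∈ shell d n <;> simp only [indicator_of_mem, indicator_of_notMem, hx,
      not_false_eq_true, zero_mul]
    exact hinv x
  have h2 : ∀ f, symbolMul _ hb (symbolMul _ (isBddSymbol_resLapSymbol d) f) =
      symbolMul _ hb' f := by
    refine symbolMul_symbolMul _ _ _ fun x => ?_
    by_cases hx : x ∈ shell d n <;> simp only [indicator_of_mem, indicator_of_notMem, hx,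
      not_false_eq_true, zero_mul]
    rw [resLapSymbol, ← mul_assoc, hinv, one_mul]
  have h3 : ∀ f, (2 * Real.pi) ^ 2 • symbolMul _ hb' f =
      shellGrad d n (shellGrad d n (shellProj d n f)) := by
    intro f
    rw [shellGrad_shellProj]
    apply Lp.ext
    have h4 := coeFn_symbolMul
      (isBddSymbol_indicator_shell (d := d) n (m := fun ξ => 2 * Real.pi * ‖ξ‖) (by fun_prop))
    filter_upwards [Lp.coeFn_smul ((2 * Real.pi) ^ 2) (symbolMul _ hb' f), coeFn_symbolMul hb' f,
      h4 f, h4 (shellGrad d n f)] with x e1 e2 e3 e4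
    refine Eq.trans ?_ e4.symm
    have e3' : (shellGrad d n f) x = _ := e3
    rw [e1, Pi.smul_apply, e2, e3', Complex.real_smul]
    by_cases hx : x ∈ shell d n
    · simp only [indicator_of_mem hx]
      push_cast
      ring
    · simp [hx]
  have h := (symbolMul _ hb).hasFDerivAt.comp_hasDerivWithinAt t (hasDerivWithinAt_resolvent hu ht)
  simp only [map_sub, map_neg, map_smul, h1, h2, h3] at h
  refine h.congr (fun s _ => (h1 _).symm) (h1 _).symm

theorem hasDerivWithinAt_shellProj (hu : IsDWSolution d μ₁ μ₂ u₀ u₁ u) (n : ℤ) {t : ℝ}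
    (ht : 0 ≤ t) :
    HasDerivWithinAt (fun s => shellProj d n (fourierL2 d (u s)))
      (shellProj d n (fourierL2 d (timeDeriv u t))) (Ici 0) t :=
  (shellProj d n ∘L fourierL2 d).hasFDerivAt.comp_hasDerivWithinAt t
    (hasDerivWithinAt_timeDeriv hu ht)

/-- The transformation `w(s) = s^{μ₁ / 2} u(s - 1)` removes the damping. -/
theorem isShellFlow_of_solution (hu : IsDWSolution d μ₁ μ₂ u₀ u₁ u) (n : ℤ) :
    IsShellFlow (massOf μ₁ μ₂) ((2 : ℝ) ^ n) (shellGrad d n)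
      (fun s => s ^ (μ₁ / 2) • shellProj d n (fourierL2 d (u (s - 1))))
      (fun s => s ^ (μ₁ / 2) • (shellProj d n (fourierL2 d (timeDeriv u (s - 1))) +
        (μ₁ / 2 * s⁻¹) • shellProj d n (fourierL2 d (u (s - 1))))) := by
  have hshift : ∀ {f : ℝ → L2 d} {f' : L2 d} {s : ℝ}, HasDerivWithinAt f f' (Ici 0) (s - 1) →
      HasDerivWithinAt (fun r => f (r - 1)) f' (Ici 1) s := by
    intro f f' s h
    have h1 := h.scomp (h := fun r : ℝ => r - 1) (s := Ici 1) s
      ((hasDerivAt_id s).sub_const 1).hasDerivWithinAt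
      (fun r hr => by simpa using hr)
    rw [one_smul] at h1
    exact h1
  have hrpow : ∀ s : ℝ, 1 ≤ s →
      HasDerivWithinAt (fun r : ℝ => r ^ (μ₁ / 2)) (s ^ (μ₁ / 2) * (μ₁ / 2 * s⁻¹)) (Ici 1) s := by
    intro s hs
    have hs0 : 0 < s := by linarith
    refine ((Real.hasDerivAt_rpow_const (p := μ₁ / 2) (Or.inl hs0.ne')).congr_deriv
      ?_).hasDerivWithinAt
    rw [Real.rpow_sub_one hs0.ne']
    ring
  refine ⟨by positivity, symbolMul_symm _, ?_, ?_, ?_, norm_shellGrad_le n⟩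
  · intro s hs
    have h1 := hshift (hasDerivWithinAt_shellProj hu n (sub_nonneg.2 hs))
    refine ((hrpow s hs).smul h1).congr_deriv ?_
    module
  · intro s hs
    have hs0 : 0 < s := by linarith
    have h1 := hshift (hasDerivWithinAt_shellProj hu n (sub_nonneg.2 hs))
    have h2 := hshift (hasDerivWithinAt_shellProj_timeDeriv hu n (sub_nonneg.2 hs))
    have h3 := ((hasDerivAt_inv hs0.ne').const_mul (μ₁ / 2)).hasDerivWithinAt (s := Ici 1)
    refine ((hrpow s hs).smul (h2.add (h3.smul h1))).congr_deriv ?_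
    simp only [map_smul, add_sub_cancel, massOf, Pi.add_apply, Pi.smul_apply']
    -- With `a = μ₁/2` the first-order terms cancel, and `μ₂ - a(a - 1)` is the mass.
    match_scalars <;> field_simp <;> ring
  · intro s hs
    have hs0 : 0 < s := by linarith
    simp only [map_smul, norm_smul]
    have h1 := le_norm_shellGrad n (fourierL2 d (u (s - 1)))
    have h2 := mul_le_mul_of_nonneg_left h1 (norm_nonneg (s ^ (μ₁ / 2)))
    linarith

end IsDWSolution

end

/-! ### Norms as square sums over the shells. -/

section shellSums

variable {d : ℕ}

theorem pairwise_disjoint_shell : Pairwise (Function.onFun Disjoint (shell d)) := by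
  intro m n hmn
  refine Set.disjoint_left.2 fun ξ hm hn => ?_
  have h1 : m < n + 1 := (zpow_lt_zpow_iff_right₀ one_lt_two).1 (hm.1.trans_lt hn.2)
  have h2 : n < m + 1 := (zpow_lt_zpow_iff_right₀ one_lt_two).1 (hn.1.trans_lt hm.2)
  omega

theorem iUnion_shell : ⋃ n, shell d n = {0}ᶜ := by
  ext ξ
  rw [mem_iUnion, mem_compl_singleton_iff]
  constructor
  · rintro ⟨n, hn⟩ rfl
    have h1 := hn.1
    rw [norm_zero, mul_zero] at h1
    exact absurd h1 (not_le.2 (by positivity))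
  · intro hξ
    have : 0 < ‖ξ‖ := norm_pos_iff.2 hξ
    exact exists_mem_Ico_zpow (by positivity) one_lt_two

theorem eLpNorm_two_sq {α : Type*} [MeasurableSpace α] {μ : Measure α} (F : α → ℂ) :
    eLpNorm F 2 μ ^ 2 = ∫⁻ x, ‖F x‖ₑ ^ 2 ∂μ := by
  have := eLpNorm_nnreal_pow_eq_lintegral (f := F) (μ := μ) (p := 2) two_ne_zero
  norm_num at this
  exact_mod_cast this

theorem eLpNorm_two_sq_eq_tsum (hd : 1 ≤ d) (F : Rd d → ℂ) :
    eLpNorm F 2 volume ^ 2 =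
      ∑' n, eLpNorm ((shell d n).indicator F) 2 (volume : Measure (Rd d)) ^ 2 := by
  -- Positive dimension makes the origin, the only frequency outside every shell, a null set.
  have : Nonempty (Fin d) := ⟨⟨0, hd⟩⟩
  simp only [eLpNorm_two_sq]
  have h1 : ∀ n, ∫⁻ x, ‖(shell d n).indicator F x‖ₑ ^ 2 = ∫⁻ x in shell d n, ‖F x‖ₑ ^ 2 := by
    intro n
    rw [← lintegral_indicator (measurableSet_shell n)]
    congr 1 with x
    by_cases hx : x ∈ shell d n <;> simp [hx]
  simp only [h1]
  rw [← lintegral_iUnion measurableSet_shell pairwise_disjoint_shell, iUnion_shell]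
  refine (setLIntegral_univ _).symm.trans (setLIntegral_congr ?_)
  refine (ae_eq_univ.2 ?_).symm
  rw [compl_compl]
  exact measure_singleton 0

theorem enorm_sq_eq_tsum_shellProj (hd : 1 ≤ d) (f : L2 d) :
    ‖f‖ₑ ^ 2 = ∑' n, ‖shellProj d n f‖ₑ ^ 2 := by
  rw [Lp.enorm_def, eLpNorm_two_sq_eq_tsum hd]
  congr 1 with n
  rw [Lp.enorm_def]
  congr 1
  refine eLpNorm_congr_ae ?_
  have h := coeFn_symbolMul
    (isBddSymbol_indicator_shell (d := d) n (m := fun _ => 1) continuous_const) f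
  filter_upwards [h] with x hx
  refine Eq.trans ?_ hx.symm
  by_cases hxn : x ∈ shell d n <;> simp [hxn]

theorem homH1Norm_sq_eq_tsum (hd : 1 ≤ d) (f : L2 d) :
    homH1Norm f ^ 2 = ∑' n, ‖shellGrad d n (fourierL2 d f)‖ₑ ^ 2 := by
  rw [homH1Norm, eLpNorm_two_sq_eq_tsum hd]
  congr 1 with n
  rw [Lp.enorm_def]
  congr 1
  refine eLpNorm_congr_ae ?_
  have h := coeFn_symbolMul
    (isBddSymbol_indicator_shell (d := d) n (m := fun ξ => 2 * Real.pi * ‖ξ‖) (by fun_prop))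
    (fourierL2 d f)
  filter_upwards [h] with x hx
  refine Eq.trans ?_ hx.symm
  by_cases hxn : x ∈ shell d n <;> simp [hxn, fourierL2_apply]

theorem norm_fourierL2 (f : L2 d) : ‖fourierL2 d f‖ = ‖f‖ := Lp.norm_fourier_eq f

theorem enorm_fourierL2 (f : L2 d) : ‖fourierL2 d f‖ₑ = ‖f‖ₑ := by
  rw [← ofReal_norm, ← ofReal_norm, norm_fourierL2]

end shellSums

theorem homH1Norm_ne_top {d : ℕ} {f : L2 d} (hf : MemH1 f) : homH1Norm f ≠ ∞ := by
  obtain ⟨g, hg⟩ := memSobolev_iff_exists_smulLeftCLM_fourier.1 hf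
  set r : Rd d → ℝ := fun ξ => (1 + ‖ξ‖ ^ 2) ^ (-(1 / 2) : ℝ) with hr
  have hrb : IsBddSymbol r := by
    refine ⟨by rw [hr]; fun_prop, 1, fun x => ?_⟩
    rw [hr, abs_of_nonneg (by positivity)]
    exact Real.rpow_le_one_of_one_le_of_nonpos (by nlinarith [sq_nonneg ‖x‖]) (by norm_num)
  have hrt : (fun ξ => (r ξ : ℂ)).HasTemperateGrowth := by
    rw [hr]; fun_prop
  have h1 : (𝓕 f : L2 d) = symbolMul r hrb g := by
    refine toTemperedDistribution_injective ?_
    rw [toTemperedDistribution_symbolMul hrb hrt, ← hg,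
      smulLeftCLM_smulLeftCLM_apply (by fun_prop) hrt, ← Lp.fourier_toTemperedDistribution_eq]
    have h2 : ((fun x : Rd d => (((1 + ‖x‖ ^ 2) ^ ((1 : ℝ) / 2) : ℝ) : ℂ)) * fun ξ => (r ξ : ℂ)) =
        fun _ => 1 := by
      ext x
      rw [Pi.mul_apply, hr, ← Complex.ofReal_mul, ← Real.rpow_add (by positivity)]
      simp
    rw [h2, smulLeftCLM_const, one_smul]
  have h3 : homH1Norm f ≤ ENNReal.ofReal (2 * Real.pi) * eLpNorm g 2 volume := by
    rw [homH1Norm, h1]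
    refine eLpNorm_le_mul_eLpNorm_of_ae_le_mul ?_ 2
    filter_upwards [coeFn_symbolMul hrb g] with x hx
    rw [hx, norm_mul, norm_mul, Complex.norm_real, Complex.norm_real, Real.norm_eq_abs,
      Real.norm_eq_abs, abs_of_nonneg (by positivity : 0 ≤ 2 * Real.pi * ‖x‖),
      abs_of_nonneg (by positivity : 0 ≤ r x), ← mul_assoc]
    refine mul_le_mul_of_nonneg_right ?_ (norm_nonneg _)
    rw [mul_assoc (2 * Real.pi)]
    refine mul_le_of_le_one_right (by positivity) ?_
    change ‖x‖ * (1 + ‖x‖ ^ 2) ^ (-(1 / 2) : ℝ) ≤ 1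
    rw [Real.rpow_neg (by positivity), ← Real.sqrt_eq_rpow, ← div_eq_mul_inv,
      div_le_one (by positivity)]
    exact Real.le_sqrt_of_sq_le (by linarith)
  exact ne_top_of_le_ne_top (ENNReal.mul_ne_top ENNReal.ofReal_ne_top (Lp.eLpNorm_ne_top g)) h3

/-- Dominated convergence for the counting measure on the shells. -/
theorem tendsto_tsum_enorm_sq {E : Type*} [NormedAddCommGroup E] {x : ℝ → ℤ → E} {a : ℤ → ℝ≥0∞}
    (hle : ∀ t, 0 ≤ t → ∀ n, ‖x t n‖ₑ ^ 2 ≤ a n) (ha : ∑' n, a n ≠ ∞)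
    (h0 : ∀ n, Tendsto (fun t => ‖x t n‖) atTop (𝓝 0)) :
    Tendsto (fun t => ∑' n, ‖x t n‖ₑ ^ 2) atTop (𝓝 0) := by
  have h := tendsto_lintegral_filter_of_dominated_convergence (μ := Measure.count (α := ℤ))
    (l := atTop) (F := fun t n => ‖x t n‖ₑ ^ 2) (f := fun _ => 0) a
    (Eventually.of_forall fun t => measurable_of_countable _)
    ((eventually_ge_atTop 0).mono fun t ht => ae_of_all _ fun n => hle t ht n)
    (by rwa [lintegral_count]) (ae_of_all _ fun n => ?_)
  · simpa only [lintegral_count, lintegral_zero] using h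
  · have h1 : Tendsto (fun t => ‖x t n‖ₑ) atTop (𝓝 0) := by
      have := (ENNReal.continuous_ofReal.tendsto 0).comp (h0 n)
      simpa [Function.comp_def, ofReal_norm] using this
    simpa using ENNReal.Tendsto.pow (n := 2) h1

theorem enorm_sq_le_of_norm_le {E F : Type*} [NormedAddCommGroup E] [NormedAddCommGroup F]
    {x : E} {a b c : F} {C : ℝ} (h : ‖x‖ ≤ C * (‖a‖ + ‖b‖ + ‖c‖)) :
    ‖x‖ₑ ^ 2 ≤ ENNReal.ofReal (3 * C ^ 2) * (‖a‖ₑ ^ 2 + ‖b‖ₑ ^ 2 + ‖c‖ₑ ^ 2) := by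
  simp only [← ofReal_norm]
  rw [← ENNReal.ofReal_pow (norm_nonneg _), ← ENNReal.ofReal_pow (norm_nonneg _),
    ← ENNReal.ofReal_pow (norm_nonneg _), ← ENNReal.ofReal_pow (norm_nonneg _),
    ← ENNReal.ofReal_add (by positivity) (by positivity),
    ← ENNReal.ofReal_add (by positivity) (by positivity), ← ENNReal.ofReal_mul (by positivity)]
  refine ENNReal.ofReal_le_ofReal ?_
  have h1 : ‖x‖ ^ 2 ≤ C ^ 2 * (‖a‖ + ‖b‖ + ‖c‖) ^ 2 := by
    rw [← mul_pow]
    exact pow_le_pow_left₀ (norm_nonneg _) h 2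
  have h2 : (‖a‖ + ‖b‖ + ‖c‖) ^ 2 ≤ 3 * (‖a‖ ^ 2 + ‖b‖ ^ 2 + ‖c‖ ^ 2) := by
    nlinarith [sq_nonneg (‖a‖ - ‖b‖), sq_nonneg (‖b‖ - ‖c‖), sq_nonneg (‖a‖ - ‖c‖)]
  nlinarith [mul_le_mul_of_nonneg_left h2 (sq_nonneg C)]

/-! ### From shell bounds to decay of the solution. -/

section decay

variable {d : ℕ} {μ₁ μ₂ : ℝ} {u₀ u₁ : L2 d} {u : ℝ → L2 d}

/-- The size of the initial data in a shell. -/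
noncomputable def shellData (u₀ u₁ : L2 d) (n : ℤ) : ℝ :=
  ‖shellProj d n (fourierL2 d u₀)‖ + ‖shellProj d n (fourierL2 d u₁)‖ +
    ‖shellGrad d n (fourierL2 d u₀)‖

/-- The localized solution after removal of the damping. -/
noncomputable def shellSol (μ₁ : ℝ) (u : ℝ → L2 d) (n : ℤ) (s : ℝ) : L2 d :=
  s ^ (μ₁ / 2) • shellProj d n (fourierL2 d (u (s - 1)))

/-- The derivative of `shellSol`. -/
noncomputable def shellVel (μ₁ : ℝ) (u : ℝ → L2 d) (n : ℤ) (s : ℝ) : L2 d :=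
  s ^ (μ₁ / 2) • (shellProj d n (fourierL2 d (timeDeriv u (s - 1))) +
    (μ₁ / 2 * s⁻¹) • shellProj d n (fourierL2 d (u (s - 1))))

/-- The localized time derivative, with the weight of `shellSol`. -/
noncomputable def shellRate (μ₁ : ℝ) (u : ℝ → L2 d) (n : ℤ) (s : ℝ) : L2 d :=
  s ^ (μ₁ / 2) • shellProj d n (fourierL2 d (timeDeriv u (s - 1)))

/-- The energy involves `∂ₜu`, whereas the flow velocity also contains the derivative of the weight.
The difference is `(μ₁/2) s⁻¹ w`, of the same order. -/
theorem norm_shellRate_le (μ₁ : ℝ) (u : ℝ → L2 d) (n : ℤ) {s K : ℝ} (hs : 0 < s)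
    (hv : ‖shellVel μ₁ u n s‖ ≤ K) (hw : ‖shellSol μ₁ u n s‖ ≤ K * s) :
    ‖shellRate μ₁ u n s‖ ≤ (1 + |μ₁|) * K := by
  have h : shellRate μ₁ u n s =
      shellVel μ₁ u n s - (μ₁ / 2 * s⁻¹) • shellSol μ₁ u n s := by
    simp only [shellRate, shellVel, shellSol]
    module
  rw [h]
  refine (norm_sub_le _ _).trans ?_
  have h1 : s⁻¹ * ‖shellSol μ₁ u n s‖ ≤ K := by rwa [inv_mul_le_iff₀ hs, mul_comm]
  rw [norm_smul, Real.norm_eq_abs, abs_mul, abs_div, abs_two, abs_of_pos (inv_pos.2 hs), mul_assoc]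
  have h2 : 0 ≤ s⁻¹ * ‖shellSol μ₁ u n s‖ := by positivity
  nlinarith [abs_nonneg μ₁, mul_le_mul_of_nonneg_left h1 (abs_nonneg μ₁)]

theorem flowData_shell_le (hu : IsDWSolution d μ₁ μ₂ u₀ u₁ u) (n : ℤ) :
    flowData (shellGrad d n) (shellSol μ₁ u n) (shellVel μ₁ u n) ≤
      (1 + |μ₁|) * shellData u₀ u₁ n := by
  simp only [flowData, shellSol, shellVel, sub_self, hu.initial, hu.initial_deriv, Real.one_rpow,
    one_smul, inv_one, mul_one, shellGrad_shellProj, shellData]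
  have h1 := norm_add_le (shellProj d n (fourierL2 d u₁))
    ((μ₁ / 2) • shellProj d n (fourierL2 d u₀))
  rw [norm_smul, Real.norm_eq_abs, abs_div, abs_two] at h1
  have h2 := abs_nonneg μ₁
  nlinarith [norm_nonneg (shellProj d n (fourierL2 d u₀)),
    norm_nonneg (shellProj d n (fourierL2 d u₁)), norm_nonneg (shellGrad d n (fourierL2 d u₀)),
    mul_nonneg h2 (norm_nonneg (shellProj d n (fourierL2 d u₀))),
    mul_nonneg h2 (norm_nonneg (shellProj d n (fourierL2 d u₁))),
    mul_nonneg h2 (norm_nonneg (shellGrad d n (fourierL2 d u₀)))]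

theorem tendsto_tsum_of_shellData (hd : 1 ≤ d) (h₀ : MemH1 u₀) {x : ℝ → ℤ → L2 d} {C : ℝ}
    (hle : ∀ t, 0 ≤ t → ∀ n, ‖x t n‖ ≤ C * shellData u₀ u₁ n)
    (h0 : ∀ n, Tendsto (fun t => ‖x t n‖) atTop (𝓝 0)) :
    Tendsto (fun t => ∑' n, ‖x t n‖ₑ ^ 2) atTop (𝓝 0) := by
  refine tendsto_tsum_enorm_sq (fun t ht n => enorm_sq_le_of_norm_le (hle t ht n)) ?_ h0
  rw [ENNReal.tsum_mul_left, ENNReal.tsum_add, ENNReal.tsum_add, ← enorm_sq_eq_tsum_shellProj hd,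
    ← enorm_sq_eq_tsum_shellProj hd, ← homH1Norm_sq_eq_tsum hd]
  refine ENNReal.mul_ne_top ENNReal.ofReal_ne_top ?_
  refine ENNReal.add_ne_top.2 ⟨ENNReal.add_ne_top.2 ⟨?_, ?_⟩, ?_⟩
  · exact ENNReal.pow_ne_top enorm_ne_top
  · exact ENNReal.pow_ne_top enorm_ne_top
  · exact ENNReal.pow_ne_top (homH1Norm_ne_top h₀)

theorem tendsto_norm_div_of_bounded {E : Type*} [NormedAddCommGroup E] [NormedSpace ℝ E]
    {x : ℝ → E} {g : ℝ → ℝ} {A : ℝ}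
    (hx : ∀ s, 1 ≤ s → ‖x s‖ ≤ A) (hg : Tendsto g atTop atTop) :
    Tendsto (fun t => ‖(g (1 + t))⁻¹ • x (1 + t)‖) atTop (𝓝 0) := by
  have h1 : Tendsto (fun t : ℝ => 1 + t) atTop atTop := tendsto_atTop_add_const_left _ _ tendsto_id
  have h2 : Tendsto (fun t => |(g (1 + t))⁻¹| * A) atTop (𝓝 0) := by
    simpa using (tendsto_inv_atTop_zero.comp (hg.comp h1)).abs.mul_const A
  refine squeeze_zero' (Eventually.of_forall fun t => norm_nonneg _) ?_ h2
  filter_upwards [eventually_ge_atTop 0] with t ht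
  rw [norm_smul, Real.norm_eq_abs]
  gcongr
  exact hx _ (by linarith)

theorem ENNReal.tendsto_zero_of_sq {α : Type*} {l : Filter α} {f : α → ℝ≥0∞}
    (h : Tendsto (fun t => f t ^ 2) l (𝓝 0)) : Tendsto f l (𝓝 0) := by
  have h1 := (ENNReal.continuous_rpow_const (y := (1 / 2 : ℝ))).tendsto 0 |>.comp h
  rw [ENNReal.zero_rpow_of_pos (by norm_num)] at h1
  refine h1.congr fun t => ?_
  rw [Function.comp_apply, ← ENNReal.rpow_natCast, ← ENNReal.rpow_mul]
  norm_num

/-- Decay of the `L²` norm from bounds of the shells that are uniform. -/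
theorem tendsto_norm_of_shell_bound (hd : 1 ≤ d) (h₀ : MemH1 u₀)
    (hu : IsDWSolution d μ₁ μ₂ u₀ u₁ u) {h : ℝ → ℝ} {C : ℝ} (hC : 0 ≤ C)
    (hpos : ∀ s, 1 ≤ s → 0 < h s) (htop : Tendsto h atTop atTop)
    (hb : ∀ n s, 1 ≤ s → ‖shellSol μ₁ u n s‖ ≤
      C * h s * flowData (shellGrad d n) (shellSol μ₁ u n) (shellVel μ₁ u n)) :
    Tendsto (fun t => (h (1 + t))⁻¹ * (1 + t) ^ (μ₁ / 2) * ‖u t‖) atTop (𝓝 0) := by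
  have key := tendsto_tsum_of_shellData (u₁ := u₁) (C := C * (1 + |μ₁|)) hd h₀
    (x := fun t n => (h (1 + t))⁻¹ • shellSol μ₁ u n (1 + t)) ?_ ?_
  · have h1 : ∀ t, ∑' n, ‖(h (1 + t))⁻¹ • shellSol μ₁ u n (1 + t)‖ₑ ^ 2 =
        ‖((h (1 + t))⁻¹ * (1 + t) ^ (μ₁ / 2)) • fourierL2 d (u t)‖ₑ ^ 2 := by
      intro t
      rw [enorm_sq_eq_tsum_shellProj hd]
      simp only [shellSol, smul_smul, map_smul, add_sub_cancel_left]
    simp only [h1] at key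
    have h2 := (ENNReal.tendsto_toReal ENNReal.zero_ne_top).comp (ENNReal.tendsto_zero_of_sq key)
    refine h2.congr' ?_
    filter_upwards [eventually_ge_atTop 0] with t ht
    have h3 := hpos (1 + t) (by linarith)
    rw [Function.comp_apply, toReal_enorm, norm_smul, norm_fourierL2, Real.norm_eq_abs,
      abs_of_nonneg (by positivity)]
  · intro t ht n
    have hs : 1 ≤ 1 + t := by linarith
    have h3 := hpos (1 + t) hs
    rw [norm_smul, norm_inv, Real.norm_eq_abs, abs_of_pos h3, inv_mul_le_iff₀ h3]
    refine (hb n _ hs).trans ?_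
    calc _ ≤ C * h (1 + t) * ((1 + |μ₁|) * shellData u₀ u₁ n) := by
          gcongr
          exact flowData_shell_le hu n
      _ = _ := by ring
  · intro n
    obtain ⟨A, hA⟩ := (isShellFlow_of_solution hu n).exists_energy_bound
    exact tendsto_norm_div_of_bounded (x := shellSol μ₁ u n) (fun s hs => (hA s hs).1) htop

theorem tendsto_tsum_shellGrad (hd : 1 ≤ d) (h₀ : MemH1 u₀)
    (hu : IsDWSolution d μ₁ μ₂ u₀ u₁ u) {g : ℝ → ℝ} {C : ℝ} (hC : 0 ≤ C)
    (hpos : ∀ s, 1 ≤ s → 0 < g s) (htop : Tendsto g atTop atTop)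
    (he : ∀ n s, 1 ≤ s → ‖shellGrad d n (shellSol μ₁ u n s)‖ ≤
      C * g s * flowData (shellGrad d n) (shellSol μ₁ u n) (shellVel μ₁ u n)) :
    Tendsto (fun t => ∑' n, ‖(g (1 + t))⁻¹ • shellGrad d n (shellSol μ₁ u n (1 + t))‖ₑ ^ 2)
      atTop (𝓝 0) := by
  refine tendsto_tsum_of_shellData (u₁ := u₁) (C := C * (1 + |μ₁|)) hd h₀ ?_ ?_
  · intro t ht n
    have hs : 1 ≤ 1 + t := by linarith
    have h3 := hpos (1 + t) hs
    rw [norm_smul, norm_inv, Real.norm_eq_abs, abs_of_pos h3, inv_mul_le_iff₀ h3]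
    refine (he n _ hs).trans ?_
    refine (mul_le_mul_of_nonneg_left (flowData_shell_le hu n) (by positivity)).trans_eq ?_
    ring
  · intro n
    obtain ⟨A, hA⟩ := (isShellFlow_of_solution hu n).exists_energy_bound
    exact tendsto_norm_div_of_bounded (x := fun s => shellGrad d n (shellSol μ₁ u n s))
      (fun s hs => (hA s hs).2.2) htop

theorem tendsto_tsum_shellRate (hd : 1 ≤ d) (h₀ : MemH1 u₀)
    (hu : IsDWSolution d μ₁ μ₂ u₀ u₁ u) {g : ℝ → ℝ} {C : ℝ} (hC : 0 ≤ C)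
    (hpos : ∀ s, 1 ≤ s → 0 < g s) (htop : Tendsto g atTop atTop)
    (hb : ∀ n s, 1 ≤ s → ‖shellSol μ₁ u n s‖ ≤
      C * (g s * s) * flowData (shellGrad d n) (shellSol μ₁ u n) (shellVel μ₁ u n))
    (he : ∀ n s, 1 ≤ s → ‖shellVel μ₁ u n s‖ ≤
      C * g s * flowData (shellGrad d n) (shellSol μ₁ u n) (shellVel μ₁ u n)) :
    Tendsto (fun t => ∑' n, ‖(g (1 + t))⁻¹ • shellRate μ₁ u n (1 + t)‖ₑ ^ 2)
      atTop (𝓝 0) := by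
  refine tendsto_tsum_of_shellData (u₁ := u₁) (C := C * (1 + |μ₁|) * (1 + |μ₁|)) hd h₀ ?_ ?_
  · intro t ht n
    have hs : 1 ≤ 1 + t := by linarith
    have h3 := hpos (1 + t) hs
    rw [norm_smul, norm_inv, Real.norm_eq_abs, abs_of_pos h3, inv_mul_le_iff₀ h3]
    have hDle := flowData_shell_le hu n
    refine (norm_shellRate_le μ₁ u n (K := C * g (1 + t) * ((1 + |μ₁|) * shellData u₀ u₁ n))
      (by linarith) ((he n _ hs).trans ?_) ((hb n _ hs).trans ?_)).trans_eq ?_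
    · exact mul_le_mul_of_nonneg_left hDle (by positivity)
    · refine (mul_le_mul_of_nonneg_left hDle (by positivity)).trans_eq ?_
      ring
    · ring
  · intro n
    obtain ⟨A, hA⟩ := (isShellFlow_of_solution hu n).exists_energy_bound
    refine tendsto_norm_div_of_bounded (A := (1 + |μ₁|) * A) (x := shellRate μ₁ u n)
      (fun s hs => norm_shellRate_le μ₁ u n (by linarith) (hA s hs).2.1 ((hA s hs).1.trans ?_)) htop
    exact le_mul_of_one_le_right ((norm_nonneg _).trans (hA s hs).1) hs

/-- Decay of the energy from bounds of the shells that are uniform. -/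
theorem tendsto_energyNorm_of_shell_bound (hd : 1 ≤ d) (h₀ : MemH1 u₀)
    (hu : IsDWSolution d μ₁ μ₂ u₀ u₁ u) {g : ℝ → ℝ} {C : ℝ} (hC : 0 ≤ C)
    (hpos : ∀ s, 1 ≤ s → 0 < g s) (htop : Tendsto g atTop atTop)
    (hb : ∀ n s, 1 ≤ s → ‖shellSol μ₁ u n s‖ ≤
      C * (g s * s) * flowData (shellGrad d n) (shellSol μ₁ u n) (shellVel μ₁ u n))
    (he : ∀ n s, 1 ≤ s → ‖shellVel μ₁ u n s‖ + ‖shellGrad d n (shellSol μ₁ u n s)‖ ≤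
      C * g s * flowData (shellGrad d n) (shellSol μ₁ u n) (shellVel μ₁ u n)) :
    Tendsto (fun t => ENNReal.ofReal ((g (1 + t))⁻¹ * (1 + t) ^ (μ₁ / 2)) *
      energyNorm (u t) (timeDeriv u t)) atTop (𝓝 0) := by
  have key := (tendsto_tsum_shellGrad hd h₀ hu hC hpos htop
      (fun n s hs => (le_add_of_nonneg_left (norm_nonneg _)).trans (he n s hs))).add
    (tendsto_tsum_shellRate hd h₀ hu hC hpos htop hb
      (fun n s hs => (le_add_of_nonneg_right (norm_nonneg _)).trans (he n s hs)))
  rw [add_zero] at key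
  have h1 : ∀ t, ∑' n, ‖(g (1 + t))⁻¹ • shellGrad d n (shellSol μ₁ u n (1 + t))‖ₑ ^ 2
      = ‖(g (1 + t))⁻¹ * (1 + t) ^ (μ₁ / 2)‖ₑ ^ 2 * homH1Norm (u t) ^ 2 := by
    intro t
    rw [homH1Norm_sq_eq_tsum hd, ← ENNReal.tsum_mul_left]
    simp only [shellSol, smul_smul, map_smul, add_sub_cancel_left, shellGrad_shellProj,
      enorm_smul, mul_pow]
  have h2 : ∀ t, ∑' n, ‖(g (1 + t))⁻¹ • shellRate μ₁ u n (1 + t)‖ₑ ^ 2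
      = ‖(g (1 + t))⁻¹ * (1 + t) ^ (μ₁ / 2)‖ₑ ^ 2 * ‖timeDeriv u t‖ₑ ^ 2 := by
    intro t
    rw [← enorm_fourierL2, enorm_sq_eq_tsum_shellProj hd, ← ENNReal.tsum_mul_left]
    simp only [shellRate, add_sub_cancel_left, smul_smul, enorm_smul, mul_pow]
  simp only [h1, h2, ← mul_add] at key
  refine ENNReal.tendsto_zero_of_sq (key.congr' ?_)
  filter_upwards [eventually_ge_atTop 0] with t ht
  have h3 := hpos (1 + t) (by linarith)
  rw [mul_pow, energyNorm, ← ENNReal.rpow_natCast (_ ^ (1 / 2 : ℝ)), ← ENNReal.rpow_mul,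
    Real.enorm_eq_ofReal (by positivity)]
  simp

end decay

/-! ### The exponent `Re ν` and the conclusion. -/

theorem nu_re_of_le {μ : ℝ} (hμ : μ ≤ 1 / 4) : (nu μ).re = Real.sqrt (1 - 4 * μ) / 2 := by
  rw [nu, if_pos hμ, show (1 / 2 : ℂ) = ((1 / 2 : ℝ) : ℂ) by push_cast; rfl, ← Complex.ofReal_mul,
    Complex.ofReal_re]
  ring

theorem nu_re_of_lt {μ : ℝ} (hμ : 1 / 4 < μ) : (nu μ).re = 0 := by
  rw [nu, if_neg (not_le.2 hμ), Complex.re_mul_ofReal]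
  simp

theorem nu_re_sq {μ : ℝ} (hμ : μ ≤ 1 / 4) : 1 / 4 - (nu μ).re ^ 2 = μ := by
  rw [nu_re_of_le hμ, div_pow, Real.sq_sqrt (by linarith)]
  ring

theorem nu_re_pos {μ : ℝ} (hμ : μ < 1 / 4) : 0 < (nu μ).re := by
  rw [nu_re_of_le hμ.le]
  have : 0 < Real.sqrt (1 - 4 * μ) := Real.sqrt_pos.2 (by linarith)
  positivity

/-- This is where `μ < 0` enters: the energy weight `s^(Re ν - 1/2)` must tend to infinity for a
single shell to become negligible. -/
theorem half_lt_nu_re {μ : ℝ} (hμ : μ < 0) : 1 / 2 < (nu μ).re := by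
  rw [nu_re_of_le (by linarith)]
  have : 1 < Real.sqrt (1 - 4 * μ) := by
    rw [Real.lt_sqrt zero_le_one]
    linarith
  linarith

section

variable {d : ℕ} {μ₁ μ₂ : ℝ} {u₀ u₁ : L2 d} {u : ℝ → L2 d}

theorem isShellFlow_shellSol (hu : IsDWSolution d μ₁ μ₂ u₀ u₁ u) (n : ℤ) :
    IsShellFlow (massOf μ₁ μ₂) ((2 : ℝ) ^ n) (shellGrad d n) (shellSol μ₁ u n)
      (shellVel μ₁ u n) :=
  isShellFlow_of_solution hu n

theorem tendsto_norm_of_profile (hd : 1 ≤ d) (h₀ : MemH1 u₀) (hu : IsDWSolution d μ₁ μ₂ u₀ u₁ u)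
    {h h' k : ℝ → ℝ} {c K : ℝ} (hp : IsEulerProfile (massOf μ₁ μ₂) h h' k c K) :
    Tendsto (fun t => (h (1 + t))⁻¹ * (1 + t) ^ (μ₁ / 2) * ‖u t‖) atTop (𝓝 0) := by
  have hc := hp.c_nonneg
  have hK := hp.K_nonneg
  have htop : Tendsto h atTop atTop := by
    refine tendsto_atTop_mono' _ ?_ Real.tendsto_sqrt_atTop
    filter_upwards [eventually_ge_atTop 1] with s hs
    rw [Real.sqrt_le_left (by linarith [hp.one_le hs])]
    exact hp.sqrt_le s hs
  refine tendsto_norm_of_shell_bound hd h₀ hu (C := 4 * Real.exp |massOf μ₁ μ₂| * (1 + 2 *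
      ((1 + c) * (1 + 2 * (1 + K * (1 + c))) + 2 * (1 + K * (1 + c)))))
    (by positivity) (fun s hs => by linarith [hp.one_le hs]) htop (fun n s hs => ?_)
  have hf := isShellFlow_shellSol hu n
  exact hf.norm_le_of_innerBound (by positivity) (fun s hs => hp.one_le hs) hp.mono
    (hf.innerBound_of_profile hp) hs

theorem tendsto_norm_of_quarter_lt (hd : 1 ≤ d) (h₀ : MemH1 u₀)
    (hu : IsDWSolution d μ₁ μ₂ u₀ u₁ u) (hμ : 1 / 4 < massOf μ₁ μ₂) :
    Tendsto (fun t => (Real.sqrt (1 + t))⁻¹ * (1 + t) ^ (μ₁ / 2) * ‖u t‖) atTop (𝓝 0) := by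
  refine tendsto_norm_of_shell_bound hd h₀ hu (C := 4 * Real.exp |massOf μ₁ μ₂| * (1 + 2 *
      Real.sqrt ((2 + massOf μ₁ μ₂) * Real.exp (1 / (massOf μ₁ μ₂ - 1 / 4)) *
        (2 + 2 / (massOf μ₁ μ₂ - 1 / 4)))))
    (by positivity) (fun s hs => Real.sqrt_pos.2 (by linarith)) Real.tendsto_sqrt_atTop
    (fun n s hs => ?_)
  have hf := isShellFlow_shellSol hu n
  exact hf.norm_le_of_innerBound (by positivity)
    (fun s hs => Real.one_le_sqrt.2 hs)
    (fun a _ b _ hab => Real.sqrt_le_sqrt hab) (hf.innerBound_of_quarter_lt hμ) hs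

theorem tendsto_energyNorm_of_profile (hd : 1 ≤ d) (h₀ : MemH1 u₀)
    (hu : IsDWSolution d μ₁ μ₂ u₀ u₁ u) {h h' k : ℝ → ℝ} {c K : ℝ}
    (hp : IsEulerProfile (massOf μ₁ μ₂) h h' k c K)
    (hmono : MonotoneOn (fun s => h s / s) (Ici 1))
    (htop : Tendsto (fun s => h s / s) atTop atTop) :
    Tendsto (fun t => ENNReal.ofReal ((h (1 + t) / (1 + t))⁻¹ * (1 + t) ^ (μ₁ / 2)) *
      energyNorm (u t) (timeDeriv u t)) atTop (𝓝 0) := by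
  have hc := hp.c_nonneg
  have hK := hp.K_nonneg
  refine tendsto_energyNorm_of_shell_bound hd h₀ hu (g := fun s => h s / s)
    (C := 4 * Real.exp |massOf μ₁ μ₂| * (1 + 2 *
      ((1 + c) * (1 + 2 * (1 + K * (1 + c))) + 2 * (1 + K * (1 + c)))))
    (by positivity) (fun s hs => div_pos (by linarith [hp.one_le hs]) (by linarith)) htop
    (fun n s hs => ?_) (fun n s hs => ?_)
  · have hf := isShellFlow_shellSol hu n
    rw [div_mul_cancel₀ _ (by linarith : s ≠ 0)]
    exact hf.norm_le_of_innerBound (by positivity) (fun s hs => hp.one_le hs) hp.mono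
      (hf.innerBound_of_profile hp) hs
  · have hf := isShellFlow_shellSol hu n
    refine (hf.energy_le_of_innerBound (by positivity) (fun s hs => hp.one_le hs) hmono
      (hf.innerBound_of_profile hp) hs).trans ?_
    have h1 : 0 ≤ h s / s := div_nonneg (by linarith [hp.one_le hs]) (by linarith)
    have h2 : 0 ≤ flowData (shellGrad d n) (shellSol μ₁ u n) (shellVel μ₁ u n) :=
      IsShellFlow.flowData_nonneg
    gcongr
    norm_num

theorem dampedWave_decay (hd : 1 ≤ d) (h₀ : MemH1 u₀) (hu : IsDWSolution d μ₁ μ₂ u₀ u₁ u) :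
    (massOf μ₁ μ₂ < 0 →
      Tendsto (fun t : ℝ => ENNReal.ofReal ((1 + t) ^ (1 / 2 - (nu (massOf μ₁ μ₂)).re + μ₁ / 2))
        * energyNorm (u t) (timeDeriv u t)) atTop (𝓝 0)) ∧
    (massOf μ₁ μ₂ ≠ 1 / 4 →
      Tendsto (fun t : ℝ => (1 + t) ^ (-(1 / 2) - (nu (massOf μ₁ μ₂)).re + μ₁ / 2) * ‖u t‖)
        atTop (𝓝 0)) ∧
    (massOf μ₁ μ₂ = 1 / 4 →
      Tendsto (fun t : ℝ => (1 + t) ^ (-(1 / 2) + μ₁ / 2) * (1 + Real.log (1 + t))⁻¹ * ‖u t‖)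
        atTop (𝓝 0)) := by
  have hprof : massOf μ₁ μ₂ < 1 / 4 → IsEulerProfile (massOf μ₁ μ₂) _ _ _ _ _ := fun hμ => by
    have := isEulerProfile_rpow (nu_re_pos hμ)
    rwa [nu_re_sq hμ.le] at this
  refine ⟨fun hμ => ?_, fun hμ => ?_, fun hμ => ?_⟩
  · have hν := half_lt_nu_re hμ
    have hdiv : ∀ s : ℝ, 0 < s → s ^ (1 / 2 + (nu (massOf μ₁ μ₂)).re) / s =
        s ^ ((nu (massOf μ₁ μ₂)).re - 1 / 2) := by
      intro s hs
      rw [← Real.rpow_sub_one hs.ne']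
      congr 1
      ring
    have h1 := tendsto_energyNorm_of_profile hd h₀ hu (hprof (by linarith)) ?_ ?_
    · refine h1.congr' ?_
      filter_upwards [eventually_ge_atTop 0] with t ht
      have hs : 0 < 1 + t := by linarith
      rw [hdiv _ hs, ← Real.rpow_neg hs.le, ← Real.rpow_add hs]
      congr 3
      ring
    · intro a ha b hb hab
      have ha0 : 0 < a := by linarith [mem_Ici.1 ha]
      simp only
      rw [hdiv a ha0, hdiv b (by linarith)]
      exact Real.rpow_le_rpow ha0.le hab (by linarith)
    · refine (tendsto_rpow_atTop (by linarith : 0 < (nu (massOf μ₁ μ₂)).re - 1 / 2)).congr' ?_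
      filter_upwards [eventually_gt_atTop 0] with s hs
      exact (hdiv s hs).symm
  · rcases lt_or_gt_of_ne hμ with hμ | hμ
    · refine (tendsto_norm_of_profile hd h₀ hu (hprof hμ)).congr' ?_
      filter_upwards [eventually_ge_atTop 0] with t ht
      have hs : 0 < 1 + t := by linarith
      rw [← Real.rpow_neg hs.le, ← Real.rpow_add hs]
      congr 2
      ring
    · refine (tendsto_norm_of_quarter_lt hd h₀ hu hμ).congr' ?_
      filter_upwards [eventually_ge_atTop 0] with t ht
      have hs : 0 < 1 + t := by linarith
      rw [nu_re_of_lt hμ, Real.sqrt_eq_rpow, ← Real.rpow_neg hs.le, ← Real.rpow_add hs]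
      congr 2
      ring
  · have hp : IsEulerProfile (massOf μ₁ μ₂) _ _ _ _ _ := hμ ▸ isEulerProfile_log
    refine (tendsto_norm_of_profile hd h₀ hu hp).congr' ?_
    filter_upwards [eventually_ge_atTop 0] with t ht
    have hs : 0 < 1 + t := by linarith
    rw [mul_inv, ← Real.rpow_neg hs.le, Real.rpow_add hs]
    ring

end

theorem theorem1p3 (d : ℕ) (hd : 1 ≤ d) :
    (∀ (μ : ℝ) (v₀ v₁ : L2 d) (v : ℝ → L2 d), MemH1 v₀ → IsKGSolution d μ v₀ v₁ v →
      (μ < 0 →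
        Tendsto (fun t : ℝ => ENNReal.ofReal ((1 + t) ^ (1 / 2 - (nu μ).re))
          * energyNorm (v t) (timeDeriv v t)) atTop (𝓝 0)) ∧
      (μ ≠ 1 / 4 →
        Tendsto (fun t : ℝ => (1 + t) ^ (-(1 / 2) - (nu μ).re) * ‖v t‖) atTop (𝓝 0)) ∧
      (μ = 1 / 4 →
        Tendsto (fun t : ℝ => (1 + t) ^ (-(1 / 2) : ℝ) * (1 + Real.log (1 + t))⁻¹ * ‖v t‖)
          atTop (𝓝 0))) ∧
    (∀ (μ₁ μ₂ : ℝ) (u₀ u₁ : L2 d) (u : ℝ → L2 d), MemH1 u₀ → IsDWSolution d μ₁ μ₂ u₀ u₁ u →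
      (massOf μ₁ μ₂ < 0 →
        Tendsto (fun t : ℝ => ENNReal.ofReal ((1 + t) ^ (1 / 2 - (nu (massOf μ₁ μ₂)).re + μ₁ / 2))
          * energyNorm (u t) (timeDeriv u t)) atTop (𝓝 0)) ∧
      (massOf μ₁ μ₂ ≠ 1 / 4 →
        Tendsto (fun t : ℝ => (1 + t) ^ (-(1 / 2) - (nu (massOf μ₁ μ₂)).re + μ₁ / 2) * ‖u t‖)
          atTop (𝓝 0)) ∧
      (massOf μ₁ μ₂ = 1 / 4 →
        Tendsto (fun t : ℝ => (1 + t) ^ (-(1 / 2) + μ₁ / 2) * (1 + Real.log (1 + t))⁻¹ * ‖u t‖)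
          atTop (𝓝 0))) := by
  refine ⟨fun μ v₀ v₁ v hv₀ hv => ?_, fun μ₁ μ₂ u₀ u₁ u hu₀ hu => dampedWave_decay hd hu₀ hu⟩
  have h := dampedWave_decay hd hv₀ hv
  have hmass : massOf 0 μ = μ := by simp [massOf]
  simpa only [hmass, zero_div, add_zero, Real.rpow_zero, mul_one] using h
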